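/- **Setting.** Let $X$ be a Kähler manifold of complex dimension $n$, let $\mathcal O_X$ be its sheaf of holomorphic functions and $\Omega^p$ its sheaf of holomorphic $p$-forms. For a sheaf $\mathscr F$ of $\mathcal O_X$-modules put $\Omega^p(\mathscr F)=\Omega^p\otimes_{\mathcal O_X}\mathscr F$. A *holomorphic connection* on $\mathscr F$ is a morphism of sheaves of abelian groups $\nabla:\mathscr F\to\Omega^1(\mathscr F)$ with $\nabla(fs)=df\otimes s+f\,\nabla s$. It extends to $\nabla^{(1)}:\Omega^1(\mathscr F)\to\Omega^2(\mathscr F)$, $\nabla^{(1)}(\theta\otimes s)=d\theta\otimes s-\theta\wedge\nabla s$. The curvature $\mathcal K_\nabla=\nabla^{(1)}\circ\nabla:\mathscr F\to\Omega^2(\mathscr F)$ is $\mathcal O_X$-linear; its value at $x$ is a $2$-form $K_\nabla(x)$ on $T_xX$, of type $(2,0)$, with values in $\mathrm{End}(F(x))$, where $F(x)=\mathscr F_x/\mathfrak m_x\mathscr F_x$. The *singular set* of a coherent sheaf $\mathscr F$ is the set $\mathcal S_{\mathscr F}$ of the points $x$ where the stalk $\mathscr F_x$ is not a free $\mathcal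 O_{X,x}$-module. At the points $x\notin\mathcal S_{\mathscr F}$ put $$\Phi(\mathscr F,\nabla)(x)=\mathrm{tr}\big(K_\nabla(x)\wedge\star K_\nabla(x)\big),$$ a form of top degree, where $\star$ is the ($\mathbb C$-linear) Hodge star operator of the Kähler metric and of the orientation given by the complex structure, acting on the form part, and $\wedge$ includes the composition of endomorphisms. A morphism $f:\mathscr F\to\mathscr G$ of sheaves with connections $\alpha$, $\beta$ is *compatible* with the connections if $(1\otimes f)\circ\alpha=\beta\circ f$. **Proposition.** Let $\mathscr A,\mathscr B,\mathscr C$ be coherent sheaves on $X$ with holomorphic connections $\alpha,\beta,\gamma$, and let $0\to\mathscr A\to\mathscr B\to\mathscr C\to0$ be an exact sequence whose morphisms are compatible with the connections. Then, on $X\setminus(\mathcal S_{\mathscr A}\cup\mathcal S_{\mathscr B}\cup\mathcal S_{\mathscr C})$, $$\Phi(\mathscr B,\beta)=\Phi(\mathscr A,\alpha)+\Phi(\mathscr C,\gamma).$$ Moreover, at every such point $x$ and for all pairs $u=(u_1,u_2)$, $v=(v_1,v_2)$ of tangent vectors at $x$, $$\mathrm{tr}\big(K_\beta(u)K_\beta(v)\big)=\mathrm{tr}\big(K_\alpha(u)K_\alpha(v)\big)+\mathrm{tr}\big(K_\gamma(u)K_\gamma(v)\big).$$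 **Corollary.** Let $(\mathscr G^\bullet,\delta^\bullet)$ be a bounded complex of coherent sheaves on $X$, with holomorphic connections $\nabla^i$ on $\mathscr G^i$ such that $(1\otimes\delta^i)\nabla^i=\nabla^{i+1}\delta^i$ for all $i$. Then, for every $i$, there is exactly one holomorphic connection $\theta^i$ on the cohomology sheaf $\mathscr H^i(\mathscr G^\bullet)$ that is induced by $\nabla^i$: $\nabla^i$ restricts to a holomorphic connection on $\mathrm{Ker}(\delta^i)$, and the projection $\mathrm{Ker}(\delta^i)\to\mathscr H^i(\mathscr G^\bullet)$ is compatible with this restriction and $\theta^i$. On $X\setminus\bigcup_i\mathcal S_{\mathscr G^i}$, $$\sum_i(-1)^i\,\mathrm{tr}\big(K_{\nabla^i}\wedge\star K_{\nabla^i}\big)=\sum_i(-1)^i\,\mathrm{tr}\big(K_{\theta^i}\wedge\star K_{\theta^i}\big),$$ and also $\sum_i(-1)^i\,\mathrm{tr}\big(K_{\nabla^i}(u)K_{\nabla^i}(v)\big)=\sum_i(-1)^i\,\mathrm{tr}\big(K_{\theta^i}(u)K_{\theta^i}(v)\big)$ for all pairs $u,v$ of tangent vectors at the point. -/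

import Mathlib

open CategoryTheory Opposite TopologicalSpace
open scoped Manifold ContDiff Topology TensorProduct

noncomputable section
namespace HolConn

section Sheaves
variable (E : Type) [NormedAddCommGroup E] [NormedSpace ℂ E]
variable (X : Type) [TopologicalSpace X] [ChartedSpace E X]

/-- The structure sheaf `𝒪_X` of the complex manifold `X` modelled on `E`. On a complex manifold,
`C^∞` over `ℂ` is the same as holomorphic. -/
abbrev structureSheaf : TopCat.Sheaf CommRingCat.{0} (TopCat.of X) :=
  smoothSheafCommRing 𝓘(ℂ, E) 𝓘(ℂ) X ℂ

/-- `𝒪_X` as a presheaf of commutative rings. -/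
abbrev structurePresheaf : TopCat.Presheaf CommRingCat.{0} (TopCat.of X) :=
  (structureSheaf E X).presheaf

/-- `𝒪_X` as a sheaf of rings. -/
abbrev ringSheaf : TopCat.Sheaf RingCat.{0} (TopCat.of X) :=
  ⟨structurePresheaf E X ⋙ forget₂ CommRingCat RingCat,
    ((sheafCompose _ (forget₂ CommRingCat RingCat)).obj (structureSheaf E X)).property⟩

/-- Sheaves of `𝒪_X`-modules. -/
abbrev OMod := SheafOfModules.{0} (ringSheaf E X)

variable {X}
/-- `𝒪_X(U)`. -/
abbrev Sections (U : Opens X) : Type := ↑((structurePresheaf E X).obj (op U))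

/-- The local ring `𝒪_{X,x}`. -/
abbrev LocalRing (x : X) : Type := ↑((structurePresheaf E X).stalk x)

/-- The germ at `x` of a holomorphic function. -/
def fnGerm {U : Opens X} {x : X} (hx : x ∈ U) : Sections E U →+* LocalRing E x :=
  ((structurePresheaf E X).germ U x hx).hom

/-- `ℂ` as an `𝒪_{X,x}`-algebra through evaluation of germs at `x`, that is, as the residue field
`𝒪_{X,x} / 𝔪_x`. -/
instance instAlgebraLocalRing (x : X) : Algebra (LocalRing E x) ℂ :=
  (smoothSheafCommRing.eval 𝓘(ℂ, E) 𝓘(ℂ) X ℂ x).toAlgebra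

variable {E}

theorem LocalRing.exists_germ {x : X} (f : LocalRing E x) : ∃ (U : Opens X) (hx : x ∈ U) (g : Sections E U), fnGerm E hx g = f :=
  (structurePresheaf E X).exists_germ_eq f

namespace OMod
variable (F G : OMod E X)

/-- The underlying presheaf of modules. -/
abbrev pre : PresheafOfModules.{0} (structurePresheaf E X ⋙ forget₂ CommRingCat RingCat) := F.val

/-- The module of sections `F(U)`. -/
abbrev Sec (U : Opens X) : Type := ↑(F.pre.obj (op U))

instance (U : Opens X) : Module (Sections E U) (F.Sec U) :=
  inferInstanceAs (Module ((structurePresheaf E X ⋙ forget₂ CommRingCat RingCat).obj (op U)) (F.Sec U))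

/-- The stalk `F_x`. -/
abbrev Stalk (x : X) : Type := ↑(TopCat.Presheaf.stalk (X := TopCat.of X) F.pre.presheaf x)

instance (x : X) : Module (LocalRing E x) (F.Stalk x) :=
  PresheafOfModules.instModuleCarrierStalkCommRingCatCarrierAbPresheafOpensCarrier
    (X := TopCat.of X) F.pre x
/-- The germ at `x` of a section of `F`. -/
def germ {U : Opens X} {x : X} (hx : x ∈ U) : F.Sec U →+ F.Stalk x :=
  (TopCat.Presheaf.germ (X := TopCat.of X) F.pre.presheaf U x hx).hom

theorem germ_smul {U : Opens X} {x : X} (hx : x ∈ U) (r : Sections E U) (m : F.Sec U) :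
    F.germ hx (r • m) = fnGerm E hx r • F.germ hx m :=
  PresheafOfModules.germ_smul (X := TopCat.of X) F.pre x U hx r m

theorem exists_germ {x : X} (s : F.Stalk x) : ∃ (U : Opens X) (hx : x ∈ U) (t : F.Sec U), F.germ hx t = s :=
  TopCat.Presheaf.exists_germ_eq (X := TopCat.of X) F.pre.presheaf s


variable {F G}

/-- The map induced on stalks by a morphism of sheaves of modules, as an additive map. -/
def stalkMapAdd (f : F ⟶ G) (x : X) : F.Stalk x →+ G.Stalk x :=
  ((TopCat.Presheaf.stalkFunctor Ab (X := TopCat.of X) x).map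
      ((PresheafOfModules.toPresheaf _).map f.val)).hom

theorem stalkMapAdd_germ (f : F ⟶ G) {U : Opens X} {x : X} (hx : x ∈ U) (s : F.Sec U) :
    stalkMapAdd f x (F.germ hx s) = G.germ hx (f.val.app (op U) s) :=
  TopCat.Presheaf.stalkFunctor_map_germ_apply (X := TopCat.of X) U x hx
    ((PresheafOfModules.toPresheaf _).map f.val) s

theorem stalkMapAdd_smul (f : F ⟶ G) {U : Opens X} {x : X} (hx : x ∈ U) (r : Sections E U)
    (s : F.Sec U) : stalkMapAdd f x (fnGerm E hx r • F.germ hx s) =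
      fnGerm E hx r • stalkMapAdd f x (F.germ hx s) := by
  rw [← germ_smul, stalkMapAdd_germ, stalkMapAdd_germ, ← germ_smul]
  congr 1
  exact (f.val.app (op U)).hom.map_smul _ _

/-- The `𝒪_{X,x}`-linear map induced on stalks by a morphism of sheaves of modules. -/
def stalkMap (f : F ⟶ G) (x : X) : F.Stalk x →ₗ[LocalRing E x] G.Stalk x where
  __ := stalkMapAdd f x
  map_smul' r m := by
    obtain ⟨U, hU, r, rfl⟩ := r.exists_germ
    obtain ⟨V, i, hV, m, rfl⟩ := TopCat.Presheaf.exists_le_germ_eq (X := TopCat.of X) F.pre.presheaf m hU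
    have h : fnGerm E hU r = fnGerm E hV ((structurePresheaf E X).map (homOfLE i).op r) :=
      ((structurePresheaf E X).germ_res_apply (homOfLE i) x hV r).symm
    rw [h]
    generalize (structurePresheaf E X).map (homOfLE i).op r = r'
    exact stalkMapAdd_smul f hV r' m
end OMod

open Filter

variable (E) in
/-- The image of `x` in the preferred chart at `x`. -/
abbrev coord (x : X) : E := chartAt E x x

/-- `p`-forms of type `(p,0)` on `E`. -/
abbrev Form (E : Type) [NormedAddCommGroup E] [NormedSpace ℂ E] (p : ℕ) : Type :=
  E [⋀^Fin p]→L[ℂ] ℂ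

/-- A holomorphic function on `U ⊆ X`, read in the preferred chart at `x`. -/
def sectionInChart {U : Opens X} (x : X) (f : Sections E U) (z : E) : ℂ :=
  open Classical in
  if h : (chartAt E x).symm z ∈ U then f ⟨(chartAt E x).symm z, h⟩ else 0

theorem eventually_mem {U : Opens X} {x : X} (hx : x ∈ U) :
    ∀ᶠ z in 𝓝 (coord E x), (chartAt E x).symm z ∈ U := by
  have h := (chartAt E x).symm.continuousAt (x := coord E x) (by simp)
  exact h.eventually_mem (by simpa using U.isOpen.mem_nhds hx)

/-- The germ of a function in the preferred chart at `x`. -/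
def sectionGerm {U : Opens X} {x : X} (hx : x ∈ U) :
    Sections E U →+* Germ (𝓝 (coord E x)) ℂ where
  toFun f := (sectionInChart x f : E → ℂ)
  map_one' := Germ.coe_eq.2 <| by
    filter_upwards [eventually_mem hx] with z hz
    simp only [sectionInChart, hz, dif_pos]; rfl
  map_zero' := Germ.coe_eq.2 <| by
    filter_upwards [eventually_mem hx] with z hz
    simp only [sectionInChart, hz, dif_pos]; rfl
  map_mul' f g := Germ.coe_eq.2 <| by
    filter_upwards [eventually_mem hx] with z hz
    simp only [sectionInChart, hz, dif_pos]; rfl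
  map_add' f g := Germ.coe_eq.2 <| by
    filter_upwards [eventually_mem hx] with z hz
    simp only [sectionInChart, hz, dif_pos]; rfl

theorem sectionInChart_apply {U : Opens X} {x : X} (f : Sections E U) {z : E}
    (h : (chartAt E x).symm z ∈ U) : sectionInChart x f z = f ⟨(chartAt E x).symm z, h⟩ :=
  dif_pos h

theorem sectionGerm_res {U V : Opens X} (i : V ⟶ U) {x : X} (hV : x ∈ V) (hU : x ∈ U)
    (f : Sections E U) :
    sectionGerm hV ((structurePresheaf E X).map i.op f) = sectionGerm hU f := by
  refine Germ.coe_eq.2 ?_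
  filter_upwards [eventually_mem hU, eventually_mem hV] with z hz hz'
  exact (sectionInChart_apply _ hz').trans (sectionInChart_apply f hz).symm

/-- The cocone that induces `toGerm`. -/
def germCocone (x : X) :
    Limits.Cocone ((OpenNhds.inclusion (X := TopCat.of X) x).op ⋙ structurePresheaf E X) where
  pt := CommRingCat.of (Germ (𝓝 (coord E x)) ℂ)
  ι := { app := fun U => CommRingCat.ofHom (sectionGerm (x := x) U.unop.2)
         naturality := fun U V i => by
           ext f
           exact sectionGerm_res (E := E) (X := X) ((OpenNhds.inclusion (X := TopCat.of X) x).map i.unop)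
             V.unop.2 U.unop.2 f }

/-- Elements of `𝒪_{X,x}` as germs of functions at the image of `x` in the preferred chart at `x`. -/
def toGerm (x : X) : LocalRing E x →+* Germ (𝓝 (coord E x)) ℂ :=
  (Limits.colimit.desc _ (germCocone x)).hom

theorem toGerm_fnGerm {U : Opens X} {x : X} (hx : x ∈ U) (f : Sections E U) :
    toGerm x (fnGerm E hx f) = sectionGerm hx f :=
  congr_arg (fun a => a.hom f) (Limits.colimit.ι_desc (germCocone (E := E) x) (op ⟨U, hx⟩))


theorem value_toGerm {x : X} (f : LocalRing E x) :
    (toGerm x f).value = algebraMap (LocalRing E x) ℂ f := by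
  obtain ⟨U, hx, f, rfl⟩ := f.exists_germ
  rw [toGerm_fnGerm]
  refine Eq.trans ?_ (smoothSheafCommRing.eval_germ U x hx f).symm
  have h : (chartAt E x).symm (coord E x) = x := by simp
  have h' : (chartAt E x).symm (coord E x) ∈ U := by rwa [h]
  refine (sectionInChart_apply f h').trans ?_
  exact congr_arg (fun y : U => f y) (Subtype.ext h)

/-- Holomorphic in a neighbourhood of `z` (`C^∞` over `ℂ`). -/
def SmoothNear {V W : Type*} [NormedAddCommGroup V] [NormedSpace ℂ V] [NormedAddCommGroup W]
    [NormedSpace ℂ W] (f : V → W) (z : V) : Prop :=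
  ∀ᶠ w in 𝓝 z, ContDiffAt ℂ ∞ f w

theorem smoothNear_section [IsManifold 𝓘(ℂ, E) ∞ X] {U : Opens X} {x : X} (hx : x ∈ U)
    (f : Sections E U) : SmoothNear (sectionInChart x f) (coord E x) := by
  have hf : ContMDiff 𝓘(ℂ, E) 𝓘(ℂ) ∞ (fun y : U => f y) := smoothSheaf.contMDiff_section f
  filter_upwards [eventually_mem hx, (chartAt E x).open_target.mem_nhds (mem_chart_target E x)]
    with w hw hw'
  rw [← contMDiffAt_iff_contDiffAt]
  let g : X → ℂ := fun y => open Classical in if h : y ∈ U then f ⟨y, h⟩ else 0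
  have hg : (fun y : U => g y) = fun y : U => f y := funext fun y => dif_pos y.2
  have h1 : ContMDiffAt 𝓘(ℂ, E) 𝓘(ℂ) ∞ g ((chartAt E x).symm w) := by
    have h := hf ⟨_, hw⟩
    rw [← hg] at h
    exact contMDiffAt_subtype_iff.1 h
  have h2 : ContMDiffAt 𝓘(ℂ, E) 𝓘(ℂ, E) ∞ (chartAt E x).symm w :=
    contMDiffOn_chart_symm.contMDiffAt ((chartAt E x).open_target.mem_nhds hw')
  exact h1.comp w h2


/-- Germs of vector-valued functions in the chart at `x` form an `𝒪_{X,x}`-module. -/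
instance instModuleGerm (x : X) (W : Type*) [AddCommGroup W] [Module ℂ W] :
    Module (LocalRing E x) (Germ (𝓝 (coord E x)) W) :=
  Module.compHom _ (toGerm x)

theorem germ_smul_def {x : X} {W : Type*} [AddCommGroup W] [Module ℂ W] (f : LocalRing E x)
    (γ : Germ (𝓝 (coord E x)) W) : f • γ = toGerm x f • γ := rfl

theorem exists_smooth_rep [IsManifold 𝓘(ℂ, E) ∞ X] {x : X} (f : LocalRing E x) :
    ∃ φ : E → ℂ, SmoothNear φ (coord E x) ∧ toGerm x f = (φ : Germ (𝓝 (coord E x)) ℂ) := by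
  obtain ⟨U, hx, f, rfl⟩ := f.exists_germ
  exact ⟨_, smoothNear_section hx f, toGerm_fnGerm hx f⟩

variable (E) in
/-- The stalk `Ω^p_x` of the sheaf of holomorphic `p`-forms, in the preferred chart at `x`. -/
def FormStalk [IsManifold 𝓘(ℂ, E) ∞ X] (p : ℕ) (x : X) :
    Submodule (LocalRing E x) (Germ (𝓝 (coord E x)) (Form E p)) where
  carrier := {γ | ∃ θ : E → Form E p, SmoothNear θ (coord E x) ∧ γ = θ}
  add_mem' := by
    rintro _ _ ⟨θ, hθ, rfl⟩ ⟨η, hη, rfl⟩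
    exact ⟨θ + η, by filter_upwards [hθ, hη] with w h h' using h.add h', rfl⟩
  zero_mem' := ⟨0, Eventually.of_forall fun _ => contDiffAt_const, rfl⟩
  smul_mem' := by
    rintro f _ ⟨θ, hθ, rfl⟩
    obtain ⟨φ, hφ, h⟩ := exists_smooth_rep f
    refine ⟨fun z => φ z • θ z, by filter_upwards [hθ, hφ] with w h h' using h'.smul h, ?_⟩
    rw [germ_smul_def, h]
    rfl

/-- The exterior product of a `1`-form and a `p`-form. -/
def wedgeOne {p : ℕ} (a : Form E 1) (b : Form E p) : Form E (p + 1) :=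
  .alternatizeUncurryFin (((ContinuousAlternatingMap.ofSubsingleton ℂ E ℂ 0).symm a).smulRight b)

theorem wedgeOne_add_left {p : ℕ} (a a' : Form E 1) (b : Form E p) :
    wedgeOne (a + a') b = wedgeOne a b + wedgeOne a' b := by
  ext v
  simp [wedgeOne, ContinuousAlternatingMap.alternatizeUncurryFin_apply, add_mul, Finset.sum_add_distrib, ContinuousAlternatingMap.ofSubsingleton]

theorem wedgeOne_add_right {p : ℕ} (a : Form E 1) (b b' : Form E p) :
    wedgeOne a (b + b') = wedgeOne a b + wedgeOne a b' := by
  ext v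
  simp [wedgeOne, ContinuousAlternatingMap.alternatizeUncurryFin_apply, mul_add, Finset.sum_add_distrib]

theorem wedgeOne_smul_left {p : ℕ} (c : ℂ) (a : Form E 1) (b : Form E p) :
    wedgeOne (c • a) b = c • wedgeOne a b := by
  ext v
  simp [wedgeOne, ContinuousAlternatingMap.alternatizeUncurryFin_apply, Finset.mul_sum, mul_left_comm, mul_assoc, ContinuousAlternatingMap.ofSubsingleton]

theorem wedgeOne_smul_right {p : ℕ} (c : ℂ) (a : Form E 1) (b : Form E p) :
    wedgeOne a (c • b) = c • wedgeOne a b := by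
  ext v
  simp [wedgeOne, ContinuousAlternatingMap.alternatizeUncurryFin_apply, Finset.mul_sum, mul_left_comm]

theorem wedgeOne_apply_two (a b : Form E 1) (v : Fin 2 → E) :
    wedgeOne a b v = a ![v 0] * b ![v 1] - a ![v 1] * b ![v 0] := by
  have h0 : (0 : Fin 2).removeNth v = ![v 1] := by ext i; fin_cases i; rfl
  have h1 : (1 : Fin 2).removeNth v = ![v 0] := by ext i; fin_cases i; rfl
  have h (w : E) : (ContinuousAlternatingMap.ofSubsingleton ℂ E ℂ (0 : Fin 1)).symm a w = a ![w] := by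
    change a (fun _ => w) = _
    congr 1
    ext i; fin_cases i; rfl
  simp [wedgeOne, ContinuousAlternatingMap.alternatizeUncurryFin_apply, Fin.sum_univ_two, h, h0, h1,
    sub_eq_add_neg]

theorem wedgeOne_comm (a b : Form E 1) : wedgeOne a b = -wedgeOne b a := by
  ext v
  rw [ContinuousAlternatingMap.neg_apply, wedgeOne_apply_two, wedgeOne_apply_two]
  ring

theorem SmoothNear.wedgeOne {p : ℕ} {z : E} {a : E → Form E 1} {b : E → Form E p}
    (ha : SmoothNear a z) (hb : SmoothNear b z) :
    SmoothNear (fun w => HolConn.wedgeOne (a w) (b w)) z := by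
  filter_upwards [ha, hb] with w h h'
  have h1 := (ContinuousAlternatingMap.ofSubsingletonLIE (𝕜 := ℂ) (E := E) (F := ℂ)
    (0 : Fin 1)).symm.contDiff.contDiffAt.comp (n := ∞) w h
  exact (ContinuousAlternatingMap.alternatizeUncurryFinCLM ℂ E ℂ).contDiff.contDiffAt.comp w
    (h1.smulRight h')

theorem SmoothNear.extDeriv {p : ℕ} {z : E} {a : E → Form E p} (ha : SmoothNear a z) :
    SmoothNear (_root_.extDeriv a) z := by
  filter_upwards [ha] with w h
  exact (ContinuousAlternatingMap.alternatizeUncurryFinCLM ℂ E ℂ).contDiff.contDiffAt.comp w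
    (h.fderiv_right (m := ∞) (by simp))

/-- Exterior derivative of germs of forms. -/
def extDerivGerm {p : ℕ} {z : E} : Germ (𝓝 z) (Form E p) → Germ (𝓝 z) (Form E (p + 1)) :=
  Germ.map' extDeriv fun _ _ h => h.extDeriv

section
variable [IsManifold 𝓘(ℂ, E) ∞ X]

namespace FormStalk

/-- The exterior derivative `Ω^p_x → Ω^{p+1}_x`. -/
def d {p : ℕ} (x : X) : FormStalk E p x →+ FormStalk E (p + 1) x where
  toFun γ := ⟨extDerivGerm γ.1, by
    obtain ⟨θ, hθ, h⟩ := γ.2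
    exact ⟨extDeriv θ, hθ.extDeriv, by rw [h]; rfl⟩⟩
  map_zero' := Subtype.ext <| Germ.coe_eq.2 <| Eventually.of_forall fun z => by
    change extDeriv (fun _ => (0 : Form E p)) z = 0
    ext v
    simp [extDeriv, ContinuousAlternatingMap.alternatizeUncurryFin_apply]
  map_add' := by
    rintro ⟨_, θ, hθ, rfl⟩ ⟨_, η, hη, rfl⟩
    refine Subtype.ext <| Germ.coe_eq.2 ?_
    filter_upwards [hθ, hη] with w h h'
    exact extDeriv_add (h.differentiableAt (by simp)) (h'.differentiableAt (by simp))

/-- A germ of a function as a germ of a `0`-form. -/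
def ofFn (x : X) (f : LocalRing E x) : FormStalk E 0 x :=
  ⟨Germ.map (ContinuousAlternatingMap.constOfIsEmpty ℂ E (Fin 0)) (toGerm x f), by
    obtain ⟨φ, hφ, h⟩ := exists_smooth_rep f
    refine ⟨fun z => ContinuousAlternatingMap.constOfIsEmpty ℂ E (Fin 0) (φ z), ?_, by rw [h]; rfl⟩
    filter_upwards [hφ] with w hw
    exact (ContinuousAlternatingMap.constOfIsEmptyLIE ℂ E ℂ (Fin 0)).contDiff.contDiffAt.comp w hw⟩

/-- The differential `𝒪_{X,x} → Ω^1_x`. -/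
def dFn (x : X) (f : LocalRing E x) : FormStalk E 1 x := d x (ofFn x f)

/-- The exterior derivative `Ω^1_x → Ω^2_x`. -/
def d₁ (x : X) : FormStalk E 1 x →+ FormStalk E 2 x := d x

/-- The exterior product `Ω^1_x × Ω^1_x → Ω^2_x`. -/
def wedge (x : X) :
    FormStalk E 1 x →ₗ[LocalRing E x] FormStalk E 1 x →ₗ[LocalRing E x] FormStalk E 2 x :=
  LinearMap.mk₂ _
    (fun γ δ => ⟨Germ.map₂ wedgeOne γ.1 δ.1, by
      obtain ⟨θ, hθ, h⟩ := γ.2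
      obtain ⟨η, hη, h'⟩ := δ.2
      exact ⟨_, hθ.wedgeOne hη, by rw [h, h']; rfl⟩⟩)
    (by
      rintro ⟨_, θ, hθ, rfl⟩ ⟨_, θ', hθ', rfl⟩ ⟨_, η, hη, rfl⟩
      exact Subtype.ext <| Germ.coe_eq.2 <| Eventually.of_forall fun z => wedgeOne_add_left _ _ _)
    (by
      rintro f ⟨_, θ, hθ, rfl⟩ ⟨_, η, hη, rfl⟩
      obtain ⟨φ, hφ, h⟩ := exists_smooth_rep f
      refine Subtype.ext ?_
      let θ' : Germ (𝓝 (coord E x)) (Form E 1) := θ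
      let η' : Germ (𝓝 (coord E x)) (Form E 1) := η
      change Germ.map₂ wedgeOne (toGerm x f • θ') η' = toGerm x f • Germ.map₂ wedgeOne θ' η'
      rw [h]
      exact Germ.coe_eq.2 <| Eventually.of_forall fun z => wedgeOne_smul_left _ _ _)
    (by
      rintro ⟨_, θ, hθ, rfl⟩ ⟨_, η, hη, rfl⟩ ⟨_, η', hη', rfl⟩
      exact Subtype.ext <| Germ.coe_eq.2 <| Eventually.of_forall fun z => wedgeOne_add_right _ _ _)
    (by
      rintro f ⟨_, θ, hθ, rfl⟩ ⟨_, η, hη, rfl⟩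
      obtain ⟨φ, hφ, h⟩ := exists_smooth_rep f
      refine Subtype.ext ?_
      let θ' : Germ (𝓝 (coord E x)) (Form E 1) := θ
      let η' : Germ (𝓝 (coord E x)) (Form E 1) := η
      change Germ.map₂ wedgeOne θ' (toGerm x f • η') = toGerm x f • Germ.map₂ wedgeOne θ' η'
      rw [h]
      exact Germ.coe_eq.2 <| Eventually.of_forall fun z => wedgeOne_smul_right _ _ _)

theorem wedge_comm (x : X) (γ δ : FormStalk E 1 x) : wedge x γ δ = -wedge x δ γ := by
  obtain ⟨_, θ, hθ, rfl⟩ := γ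
  obtain ⟨_, η, hη, rfl⟩ := δ
  exact Subtype.ext <| Germ.coe_eq.2 <| Eventually.of_forall fun z => wedgeOne_comm _ _

theorem d₁_smul (x : X) (f : LocalRing E x) (γ : FormStalk E 1 x) :
    d₁ x (f • γ) = wedge x (dFn x f) γ + f • d₁ x γ := by
  obtain ⟨_, θ, hθ, rfl⟩ := γ
  obtain ⟨φ, hφ, h⟩ := exists_smooth_rep f
  refine Subtype.ext ?_
  let θ' : Germ (𝓝 (coord E x)) (Form E 1) := θ
  change extDerivGerm (toGerm x f • θ') = Germ.map₂ wedgeOne (extDerivGerm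
    (Germ.map (ContinuousAlternatingMap.constOfIsEmpty ℂ E (Fin 0)) (toGerm x f))) θ' +
      toGerm x f • extDerivGerm θ'
  rw [h]
  refine Germ.coe_eq.2 ?_
  filter_upwards [hθ, hφ] with w h1 h2
  change extDeriv (fun w => φ w • θ w) w = wedgeOne (extDeriv (fun w =>
    ContinuousAlternatingMap.constOfIsEmpty ℂ E (Fin 0) (φ w)) w) (θ w) + φ w • extDeriv θ w
  rw [extDeriv_constOfIsEmpty, wedgeOne, Equiv.symm_apply_apply, extDeriv, extDeriv,
    fderiv_fun_smul (h2.differentiableAt (by simp)) (h1.differentiableAt (by simp)),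
    ContinuousAlternatingMap.alternatizeUncurryFin_add,
    ContinuousAlternatingMap.alternatizeUncurryFin_smul]
  exact add_comm _ _

theorem d₁_dFn (x : X) (f : LocalRing E x) : d₁ x (dFn x f) = 0 := by
  obtain ⟨φ, hφ, h⟩ := exists_smooth_rep f
  refine Subtype.ext ?_
  change extDerivGerm (extDerivGerm
    (Germ.map (ContinuousAlternatingMap.constOfIsEmpty ℂ E (Fin 0)) (toGerm x f))) = 0
  rw [h]
  refine Germ.coe_eq.2 ?_
  filter_upwards [hφ] with w hw
  refine extDeriv_extDeriv_apply (r := ∞) ?_ (by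
    simp only [minSmoothness_of_isRCLikeNormedField]
    exact WithTop.coe_le_coe.2 (le_top : (2 : ℕ∞) ≤ ⊤))
  exact (ContinuousAlternatingMap.constOfIsEmptyLIE ℂ E ℂ (Fin 0)).contDiff.contDiffAt.comp w hw

/-- The value at `x` of a germ of a `p`-form, on a `p`-tuple of tangent vectors. The tangent space
`T_xX` is identified with `E` through the preferred chart at `x`, as Mathlib does; `ℂ` is the
residue field. -/
def eval {p : ℕ} (x : X) (u : Fin p → E) : FormStalk E p x →ₗ[LocalRing E x] ℂ where
  toFun γ := γ.1.value u
  map_add' := by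
    rintro ⟨_, θ, hθ, rfl⟩ ⟨_, η, hη, rfl⟩
    rfl
  map_smul' f γ := by
    change (toGerm x f • γ.1).value u = _
    rw [Germ.value_smul, value_toGerm, Algebra.smul_def]
    rfl

end FormStalk

/-- A `p`-form on `X` (a family of alternating forms on the tangent spaces `T_yX`), pulled back to
`E` by the inverse of the preferred chart at `x`. -/
def inChart {p : ℕ} (x : X) (θ : X → Form E p) (z : E) : Form E p :=
  (θ ((chartAt E x).symm z)).compContinuousLinearMap
    (mfderiv 𝓘(ℂ, E) 𝓘(ℂ, E) (chartAt E x).symm z : E →L[ℂ] E)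

/-- A `p`-form on `X` is holomorphic in a neighbourhood of `x`. -/
def IsHolomorphicFormAt {p : ℕ} (θ : X → Form E p) (x : X) : Prop :=
  SmoothNear (inChart x θ) (coord E x)

/-- The germ at `x` of a holomorphic `p`-form. -/
def formGerm {p : ℕ} (θ : X → Form E p) (x : X) (h : IsHolomorphicFormAt θ x) :
    FormStalk E p x :=
  ⟨(inChart x θ : E → Form E p), _, h, rfl⟩

/-- A holomorphic connection on `F`: a morphism of sheaves of abelian groups
`∇ : F → Ω^1 ⊗ F` with `∇(f s) = df ⊗ s + f ∇s` (additivity and the Leibniz rule give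
`ℂ`-linearity). The morphism of sheaves is given by the family of the maps on stalks,
`F_x → Ω^1_x ⊗ F_x`; such a family comes from a morphism of sheaves if and only if it maps every
section of `F` to a section of `Ω^1 ⊗ F`, and the sections of `Ω^1 ⊗ F` are the families of germs
that locally have the form `∑ θ_i ⊗ t_i` with holomorphic forms `θ_i` and sections `t_i`. -/
@[ext]
structure Connection (F : OMod E X) where
  toFun (x : X) : F.Stalk x →+ FormStalk E 1 x ⊗[LocalRing E x] F.Stalk x
  leibniz (x : X) (f : LocalRing E x) (s : F.Stalk x) :
    toFun x (f • s) = FormStalk.dFn x f ⊗ₜ s + f • toFun x s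
  continuous (U : Opens X) (s : F.Sec U) (x : X) (_ : x ∈ U) :
    ∃ (V : Opens X) (hV : V ≤ U) (_ : x ∈ V) (k : ℕ) (θ : Fin k → X → Form E 1)
      (hθ : ∀ i, ∀ y ∈ V, IsHolomorphicFormAt (θ i) y) (t : Fin k → F.Sec V),
      ∀ (y : X) (hy : y ∈ V), toFun y (F.germ (hV hy) s) =
        ∑ i, formGerm (θ i) y (hθ i y hy) ⊗ₜ F.germ hy (t i)

namespace Connection
variable {F G : OMod E X} 

/-- The morphism `f : (F, α) → (G, β)` is compatible with the connections:
`(1 ⊗ f) ∘ α = β ∘ f`. -/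
def Compatible (f : F ⟶ G) (α : Connection F) (β : Connection G) : Prop :=
  ∀ (x : X) (s : F.Stalk x),
    (OMod.stalkMap f x).lTensor (FormStalk E 1 x) (α.toFun x s) =
      β.toFun x (OMod.stalkMap f x s)

instance (p : ℕ) (x : X) : AddCommGroup (FormStalk E p x ⊗[LocalRing E x] F.Stalk x) :=
  TensorProduct.addCommGroup (R := LocalRing E x) (M := FormStalk E p x) (N := F.Stalk x)

variable (α : Connection F)

/-- The extension of a connection to `Ω^1 ⊗ F → Ω^2 ⊗ F`, `θ ⊗ s ↦ dθ ⊗ s - θ ∧ ∇s`. -/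
def ext1 (x : X) : FormStalk E 1 x ⊗[LocalRing E x] F.Stalk x →+
    FormStalk E 2 x ⊗[LocalRing E x] F.Stalk x :=
  TensorProduct.liftAddHom
    (AddMonoidHom.mk' (fun θ => AddMonoidHom.mk' (fun s => FormStalk.d₁ x θ ⊗ₜ[LocalRing E x] s -
        (FormStalk.wedge x θ).rTensor (F.Stalk x) (α.toFun x s))
      (fun s t => by
        simp only [TensorProduct.tmul_add, map_add]; abel))
      (fun θ η => by
        refine AddMonoidHom.ext fun s => ?_
        simp only [map_add, TensorProduct.add_tmul, LinearMap.rTensor_add, LinearMap.add_apply,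
          AddMonoidHom.mk'_apply, AddMonoidHom.add_apply]
        abel))
    (fun f θ s => by
      simp only [AddMonoidHom.mk'_apply, FormStalk.d₁_smul, α.leibniz, map_add, map_smul,
        LinearMap.rTensor_tmul, TensorProduct.add_tmul, TensorProduct.smul_tmul', LinearMap.rTensor_smul,
        LinearMap.smul_apply, TensorProduct.tmul_smul]
      rw [FormStalk.wedge_comm x (FormStalk.dFn x f) θ,
        TensorProduct.neg_tmul (R := LocalRing E x) (M := FormStalk E 2 x) (N := F.Stalk x)]
      abel)

theorem ext1_tmul (x : X) (θ : FormStalk E 1 x) (s : F.Stalk x) :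
    α.ext1 x (θ ⊗ₜ s) =
      FormStalk.d₁ x θ ⊗ₜ s - (FormStalk.wedge x θ).rTensor (F.Stalk x) (α.toFun x s) := rfl

theorem ext1_smul (x : X) (f : LocalRing E x)
    (t : FormStalk E 1 x ⊗[LocalRing E x] F.Stalk x) :
    α.ext1 x (f • t) =
      (FormStalk.wedge x (FormStalk.dFn x f)).rTensor (F.Stalk x) t + f • α.ext1 x t := by
  induction t using TensorProduct.induction_on with
  | zero => simp
  | add s t hs ht => rw [smul_add, map_add, hs, ht, map_add, map_add, smul_add]; abel
  | tmul θ s =>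
    rw [TensorProduct.smul_tmul', ext1_tmul, ext1_tmul, FormStalk.d₁_smul, map_smul,
      LinearMap.rTensor_smul, LinearMap.smul_apply, LinearMap.rTensor_tmul, TensorProduct.add_tmul,
      smul_sub, TensorProduct.smul_tmul']
    abel

/-- The curvature `F → Ω^2 ⊗ F`, the composition of `∇` with its extension to `Ω^1 ⊗ F`;
it is `𝒪_X`-linear. -/
def curvature (x : X) :
    F.Stalk x →ₗ[LocalRing E x] FormStalk E 2 x ⊗[LocalRing E x] F.Stalk x where
  toFun s := α.ext1 x (α.toFun x s)
  map_add' s t := by rw [map_add, map_add]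
  map_smul' f s := by
    rw [α.leibniz, map_add, ext1_tmul, ext1_smul, FormStalk.d₁_dFn, TensorProduct.zero_tmul]
    simp


end Connection

/-- The fibre `F(x) = F_x / 𝔪_x F_x = ℂ ⊗ F_x`. -/
abbrev OMod.Fiber (F : OMod E X) (x : X) : Type := ℂ ⊗[LocalRing E x] F.Stalk x

namespace Connection
variable {F : OMod E X} (α : Connection F)

/-- The value of the curvature at `x`, a `2`-form on `T_xX` with values in `End F(x)`. -/
def curvatureAt (x : X) : E [⋀^Fin 2]→ₗ[ℂ] Module.End ℂ (F.Fiber x) where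
  toFun u := ((FormStalk.eval x u).rTensor (F.Stalk x) ∘ₗ α.curvature x).liftBaseChange ℂ
  map_update_add' {inst} u i v w := by
    have h : FormStalk.eval x (Function.update u i (v + w)) =
        FormStalk.eval x (Function.update u i v) + FormStalk.eval x (Function.update u i w) :=
      LinearMap.ext fun γ => by
        obtain rfl := Subsingleton.elim inst (instDecidableEqFin 2)
        exact γ.1.value.map_update_add u i v w
    rw [h, LinearMap.rTensor_add, LinearMap.add_comp]
    exact map_add (LinearMap.liftBaseChangeEquiv ℂ) _ _
  map_update_smul' {inst} u i c v := by
    refine LinearMap.ext fun t => ?_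
    induction t using TensorProduct.induction_on with
    | zero => rw [map_zero, map_zero]
    | add a b ha hb => rw [map_add, map_add, ha, hb]
    | tmul a s =>
      rw [LinearMap.smul_apply, LinearMap.liftBaseChange_tmul, LinearMap.liftBaseChange_tmul,
        smul_comm c a]
      congr 1
      rw [LinearMap.comp_apply, LinearMap.comp_apply]
      generalize α.curvature x s = t
      induction t using TensorProduct.induction_on with
      | zero => rw [map_zero, map_zero, smul_zero]
      | add a b ha hb => rw [map_add, map_add, ha, hb, smul_add]
      | tmul γ s =>
        rw [LinearMap.rTensor_tmul, LinearMap.rTensor_tmul, TensorProduct.smul_tmul']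
        congr 1
        obtain rfl := Subsingleton.elim inst (instDecidableEqFin 2)
        exact γ.1.value.map_update_smul u i c v
  map_eq_zero_of_eq' u i j h hij := by
    have h : FormStalk.eval (E := E) x u = 0 :=
      LinearMap.ext fun γ => γ.1.value.map_eq_zero_of_eq u h hij
    rw [h, LinearMap.rTensor_zero, LinearMap.zero_comp]
    exact map_zero (LinearMap.liftBaseChangeEquiv ℂ)

end Connection
end
end Sheaves


section Coherent
variable {E : Type} [NormedAddCommGroup E] [NormedSpace ℂ E]
variable {X : Type} [TopologicalSpace X] [ChartedSpace E X]

/-- Coherent sheaves of `𝒪_X`-modules: locally finitely generated, and for finitely many sections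
over any open set the sheaf of relations is locally finitely generated. -/
def IsCoherent (F : OMod E X) : Prop :=
  (∀ x : X, ∃ (U : Opens X) (_ : x ∈ U) (k : ℕ) (s : Fin k → F.Sec U), ∀ (y : X) (hy : y ∈ U),
    Submodule.span (LocalRing E y) (Set.range fun i => F.germ hy (s i)) = ⊤) ∧
  ∀ (U : Opens X) (k : ℕ) (s : Fin k → F.Sec U) (x : X), x ∈ U →
    ∃ (V : Opens X) (hV : V ≤ U) (_ : x ∈ V) (l : ℕ) (r : Fin l → Fin k → Sections E V),
      ∀ (y : X) (hy : y ∈ V),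
        LinearMap.ker (Fintype.linearCombination (LocalRing E y) fun i => F.germ (hV hy) (s i)) =
          Submodule.span (LocalRing E y) (Set.range fun j i => fnGerm E hy (r j i))

/-- The singular set: the points where the stalk is not free. -/
def singularSet (F : OMod E X) : Set X :=
  {x | ¬ Module.Free (LocalRing E x) (F.Stalk x)}

end Coherent

section Hodge
open Module
open scoped Nat
variable {V W : Type*}

/-- Insertion of the vectors `a` in the first arguments of a form. -/
def plug {ι κ : Type*} [AddCommGroup V] [Module ℝ V] (vol : V [⋀^ι ⊕ κ]→ₗ[ℝ] ℝ) (a : ι → V) :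
    V [⋀^κ]→ₗ[ℝ] ℝ where
  toFun v := vol (Sum.elim a v)
  map_update_add' v i x y := by
    classical
    simp [← Sum.update_elim_inr]
  map_update_smul' v i c x := by
    classical
    simp [← Sum.update_elim_inr]
  map_eq_zero_of_eq' v i j h hij :=
    vol.map_eq_zero_of_eq _ (i := Sum.inr i) (j := Sum.inr j) h fun h' => hij (Sum.inr_injective h')

/-- The Hodge star operator of an oriented Euclidean space `V` of dimension `N`, on alternating
forms with values in a real vector space `W`:
`(⋆β)(v) = 1/p! ∑ vol(e_{a_1}, …, e_{a_p}, v_1, …, v_q) β(e_{a_1}, …, e_{a_p})` where `e` is an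
orthonormal basis and the sum is over all `a`. For complex `W` it is `ℂ`-linear in `β`. -/
def hodgeStar [NormedAddCommGroup V] [InnerProductSpace ℝ V] [FiniteDimensional ℝ V]
    [AddCommGroup W] [Module ℝ W] {N p q : ℕ} [Fact (finrank ℝ V = N)]
    (o : Orientation ℝ V (Fin N)) (h : p + q = N) (β : V [⋀^Fin p]→ₗ[ℝ] W) :
    V [⋀^Fin q]→ₗ[ℝ] W :=
  (p ! : ℝ)⁻¹ • ∑ a : Fin p → Fin (finrank ℝ V),
    (LinearMap.toSpanSingleton ℝ W (β (stdOrthonormalBasis ℝ V ∘ a))).compAlternatingMap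
      (plug (o.volumeForm.domDomCongr (finSumFinEquiv.trans (finCongr h)).symm)
        (stdOrthonormalBasis ℝ V ∘ a))

/-- The orientation of a complex vector space: `e_1, i e_1, e_2, i e_2, …` is positive for a complex
basis `e`. -/
def complexOrientation (V : Type*) [AddCommGroup V] [Module ℂ V] [Module ℝ V] [IsScalarTower ℝ ℂ V]
    [FiniteDimensional ℂ V] : Orientation ℝ V (Fin (finrank ℂ V * 2)) :=
  ((Complex.basisOneI.smulTower' (Module.finBasis ℂ V)).reindex finProdFinEquiv).orientation

/-- The exterior product of forms with values in an algebra. -/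
def wedgeMul [AddCommGroup V] [Module ℝ V] {A : Type*} [Ring A] [Algebra ℝ A] {p q : ℕ}
    (a : V [⋀^Fin p]→ₗ[ℝ] A) (b : V [⋀^Fin q]→ₗ[ℝ] A) : V [⋀^Fin (p + q)]→ₗ[ℝ] A :=
  ((LinearMap.mul' ℝ A).compAlternatingMap (a.domCoprod b)).domDomCongr finSumFinEquiv

end Hodge

section Kahler
open Module
variable (E : Type) [NormedAddCommGroup E] [NormedSpace ℂ E]
variable (X : Type) [TopologicalSpace X] [ChartedSpace E X]

instance instIsManifoldReal [IsManifold 𝓘(ℂ, E) ∞ X] : IsManifold 𝓘(ℝ, E) ∞ X := by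
  refine isManifold_of_contDiffOn _ _ _ fun e e' he he' => ?_
  have h := (contDiffGroupoid ∞ 𝓘(ℂ, E)).compatible he he'
  rw [contDiffGroupoid, mem_groupoid_of_pregroupoid] at h
  exact ContDiffOn.restrict_scalars ℝ h.1

/-- A Kähler metric on the complex manifold `X`: a smooth Riemannian metric that is invariant under
the complex structure, such that the `2`-form `(u, v) ↦ ⟨iu, v⟩` is closed. -/
structure KahlerMetric [IsManifold 𝓘(ℂ, E) ∞ X] where
  metric : Bundle.ContMDiffRiemannianMetric 𝓘(ℝ, E) ∞ E (fun x : X => TangentSpace 𝓘(ℝ, E) x)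
  hermitian (x : X) (u v : E) :
    (metric.inner x : E →L[ℝ] E →L[ℝ] ℝ) (Complex.I • u) (Complex.I • v) =
      (metric.inner x : E →L[ℝ] E →L[ℝ] ℝ) u v
  kahlerForm : X → E [⋀^Fin 2]→L[ℝ] ℝ
  kahlerForm_apply (x : X) (u : Fin 2 → E) : kahlerForm x u =
    (metric.inner x : E →L[ℝ] E →L[ℝ] ℝ) (Complex.I • u 0) (u 1)
  closed (x : X) (z : E) : z ∈ (chartAt E x).target → extDeriv (fun w =>
    (kahlerForm ((chartAt E x).symm w)).compContinuousLinearMap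
      (mfderiv 𝓘(ℝ, E) 𝓘(ℝ, E) (chartAt E x).symm w : E →L[ℝ] E)) z = 0

end Kahler

section Euler
open Module
variable {E : Type} [NormedAddCommGroup E] [NormedSpace ℂ E]
variable {X : Type} [TopologicalSpace X] [ChartedSpace E X] [IsManifold 𝓘(ℂ, E) ∞ X]

namespace Connection
variable {F : OMod E X} (α : Connection F)

/-- The value of the curvature at `x`, as a real alternating form. -/
def realCurvatureAt (x : X) : E [⋀^Fin 2]→ₗ[ℝ] Module.End ℂ (F.Fiber x) where
  __ := (α.curvatureAt x).toMultilinearMap.restrictScalars ℝ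
  map_eq_zero_of_eq' := (α.curvatureAt x).map_eq_zero_of_eq'

end Connection

theorem finrank_real : finrank ℝ E = finrank ℂ E * 2 := by
  rw [finrank_real_of_complex, mul_comm]

open scoped Bundle in
/-- The Hodge star on the forms on `T_xX` with values in a complex (or real) vector space. -/
def KahlerMetric.star [FiniteDimensional ℂ E] (g : KahlerMetric E X) (x : X)
    {W : Type*} [AddCommGroup W] [Module ℝ W] {p q : ℕ} (h : p + q = finrank ℂ E * 2)
    (β : E [⋀^Fin p]→ₗ[ℝ] W) : E [⋀^Fin q]→ₗ[ℝ] W :=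
  letI : Bundle.RiemannianBundle (fun x : X => TangentSpace 𝓘(ℝ, E) x) :=
    ⟨g.metric.toRiemannianMetric⟩
  letI : FiniteDimensional ℝ (TangentSpace 𝓘(ℝ, E) x) :=
    inferInstanceAs (FiniteDimensional ℝ E)
  letI : Fact (finrank ℝ (TangentSpace 𝓘(ℝ, E) x) = finrank ℂ E * 2) :=
    ⟨finrank_real (E := E)⟩
  hodgeStar (V := TangentSpace 𝓘(ℝ, E) x) (complexOrientation E) h β

/-- The form `tr(K ∧ ⋆K)` of top degree at `x`. (In complex dimension `0` there is no nonzero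
`2`-form, and the value is `0`.) -/
def Phi [FiniteDimensional ℂ E] (g : KahlerMetric E X) {F : OMod E X} (α : Connection F) (x : X) :
    E [⋀^Fin (finrank ℂ E * 2)]→ₗ[ℝ] ℂ :=
  if h : 2 + (finrank ℂ E * 2 - 2) = finrank ℂ E * 2 then
    (((LinearMap.trace ℂ (F.Fiber x)).restrictScalars ℝ).compAlternatingMap
      (wedgeMul (α.realCurvatureAt x) (g.star x h (α.realCurvatureAt x)))).domDomCongr (finCongr h)
  else 0

/-- The connection `θ` on the cohomology sheaf `H^i(K)` is induced by the connection `α` on `K^i`: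
`α` restricts to a connection `ζ` on the kernel of the differential, and `ζ` descends to `θ`. -/
def IsInduced (K : CochainComplex (OMod E X) ℤ) (i : ℤ) (α : Connection (K.X i))
    (θ : Connection (K.homology i)) : Prop :=
  ∃ ζ : Connection (K.cycles i),
    Connection.Compatible (K.iCycles i) ζ α ∧ Connection.Compatible (K.homologyπ i) ζ θ

end Euler

end HolConn
end

open HolConn

set_option linter.unusedSectionVars false

/-! The trace identity for pairs of tangent vectors is linear algebra on stalks. If the quotient in
a short exact sequence of modules with connections over $\mathcal O_{X,x}$ is free, the sequence
splits, so it stays split on the fibres at `x`. The curvatures form block triangular endomorphisms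
there, and the trace of a product is the sum over the diagonal blocks
(`StalkConnection.tracePairing_eq_add`). The form $\mathrm{tr}(K\wedge\star K)$ is a linear
combination of the numbers $\mathrm{tr}(K(u)K(v))$ whose coefficients do not depend on the sheaf
(`exists_Phi_eq_sum`), so it inherits every linear identity between them.

For a complex, put $Z^i=\mathrm{Ker}\,\delta^i$ and let $Q^i=\mathscr G^i/Z^i$, which is the image
of $\delta^i$. The sequences $0\to Z^i\to\mathscr G^i\to Q^i\to0$ and $0\to Q^{i-1}\to
Z^i\to\mathscr H^i\to0$ carry compatible connections, and the contributions of the $Q^i$ telescope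
in the alternating sum. The splitting needs $Q^i$ and $\mathscr H^i$ to be free at `x`. This comes
from `StalkConnection.free`: a finitely generated module with a connection is free. Indeed,
differentiating a relation between minimal generators gives another relation, so the coefficients of
relations vanish at `x` together with all their derivatives, and are zero by analyticity.

The connections on $Z^i$ and $\mathscr H^i$ are built on stalks. Flatness of $\Omega^1_x$ makes
$\nabla^i$ preserve the kernel, and right exactness of the tensor product lets it descend to
cohomology. `Connection.exists_of_mono` and `Connection.exists_of_epi` show that the stalk maps come
from morphisms of sheaves. -/

noncomputable section
namespace HolConn
open CategoryTheory.Limits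

/-! ### Exactness of stalks for sheaves of modules. -/

section
universe u v u' v'
variable {C : Type u'} [Category.{v'} C] {J : GrothendieckTopology C} (R : Sheaf J RingCat.{u})
  [HasSheafify J AddCommGrpCat.{v}] [J.WEqualsLocallyBijective AddCommGrpCat.{v}]

/-- Factor the underlying morphism of presheaves through its image. After sheafification the
inclusion of the image is both mono and epi, hence an isomorphism. The other factor is epi already
as a morphism of presheaves of abelian groups, and sheafification of abelian presheaves preserves
this. -/
theorem toSheaf_map_epi {M N : SheafOfModules.{v} R} (p : M ⟶ N) [Epi p] :
    Epi ((SheafOfModules.toSheaf.{v} R).map p) := by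
  let L := PresheafOfModules.sheafification.{v} (𝟙 R.obj)
  let G := SheafOfModules.forget.{v} R ⋙ PresheafOfModules.restrictScalars (𝟙 R.obj)
  let adj : L ⊣ G := PresheafOfModules.sheafificationAdjunction (𝟙 R.obj)
  let T := SheafOfModules.toSheaf.{v} R
  have hnat : L.map (G.map p) ≫ adj.counit.app N = adj.counit.app M ≫ p := adj.counit.naturality p
  have : IsIso adj.counit :=
    inferInstanceAs (IsIso (PresheafOfModules.sheafificationAdjunction (𝟙 R.obj)).counit)
  let e := factorThruImage (G.map p)
  let m := image.ι (G.map p)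
  have hem : e ≫ m = G.map p := image.fac _
  have h1 : L.map e ≫ L.map m = adj.counit.app M ≫ p ≫ inv (adj.counit.app N) := by
    rw [← L.map_comp, hem, ← Category.assoc (adj.counit.app M), ← hnat, Category.assoc,
      IsIso.hom_inv_id, Category.comp_id]
  have h2 : Epi (L.map e ≫ L.map m) := by rw [h1]; infer_instance
  have h3 : Epi (L.map m) := epi_of_epi (L.map e) _
  have h4 : Mono (L.map m) := L.map_mono m
  have h5 : IsIso (L.map m) := isIso_of_mono_of_epi _
  have h6 : Epi (T.map (L.map e)) :=
    inferInstanceAs (Epi ((PresheafOfModules.toPresheaf _ ⋙ presheafToSheaf J AddCommGrpCat).map e))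
  have h7 : T.map p = inv (T.map (adj.counit.app M)) ≫ T.map (L.map e) ≫ T.map (L.map m) ≫
      T.map (adj.counit.app N) := by
    rw [IsIso.eq_inv_comp, ← T.map_comp, ← T.map_comp, ← T.map_comp, ← Category.assoc (L.map e), h1]
    simp
  change Epi (T.map p)
  rw [h7]
  infer_instance

/-- Left exactness handles everything in a short exact sequence except the last map, which is
`toSheaf_map_epi`. -/
theorem toSheaf_preservesHomology : (SheafOfModules.toSheaf.{v} R).PreservesHomology := by
  refine ((SheafOfModules.toSheaf.{v} R).exact_tfae.out 0 2 :).1 fun S h => ?_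
  have h1 := ((SheafOfModules.toSheaf.{v} R).preservesFiniteLimits_tfae.out 3 0 :).mp
      (inferInstance : (PreservesFiniteLimits _)) S h
  have := h.epi_g
  exact ShortComplex.ShortExact.mk' h1.1 h1.2 (toSheaf_map_epi R S.g)

end

section
variable {E : Type} [NormedAddCommGroup E] [NormedSpace ℂ E]
variable {X : Type} [TopologicalSpace X] [ChartedSpace E X]

/-- The stalk functor on sheaves of modules, with values in abelian groups. -/
def stalkFunctorAb (x : X) : OMod E X ⥤ Ab.{0} :=
  SheafOfModules.toSheaf.{0} (ringSheaf E X) ⋙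
    (TopCat.Sheaf.forget Ab (TopCat.of X) ⋙ TopCat.Presheaf.stalkFunctor Ab (X := TopCat.of X) x)

theorem stalkMap_apply_eq {F G : OMod E X} (f : F ⟶ G) (x : X) (s : F.Stalk x) :
    OMod.stalkMap f x s = ((stalkFunctorAb x).map f).hom s := rfl

theorem stalkMap_exact (S : ShortComplex (OMod E X)) (h : S.Exact) (x : X) :
    Function.Exact (OMod.stalkMap S.f x) (OMod.stalkMap S.g x) := by
  have := toSheaf_preservesHomology.{0} (ringSheaf E X)
  have h1 : (S.map (SheafOfModules.toSheaf.{0} (ringSheaf E X))).Exact :=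
    h.map (SheafOfModules.toSheaf.{0} (ringSheaf E X))
  have h2 := (TopCat.Sheaf.exact_iff_stalkFunctor_map_exact (C := Ab.{0}) (X := TopCat.of X) _).1 h1 x
  have h3 := (ShortComplex.ab_exact_iff_function_exact _).1 h2
  exact h3

theorem stalkMap_injective {F G : OMod E X} (f : F ⟶ G) [Mono f] (x : X) :
    Function.Injective (OMod.stalkMap f x) := by
  have h1 : Mono ((SheafOfModules.toSheaf.{0} (ringSheaf E X)).map f) := inferInstance
  have h2 := @Functor.map_mono _ _ _ _ (TopCat.Sheaf.forget Ab (TopCat.of X) ⋙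
    TopCat.Presheaf.stalkFunctor Ab (X := TopCat.of X) x) inferInstance _ _
      ((SheafOfModules.toSheaf.{0} (ringSheaf E X)).map f) h1
  exact (AddCommGrpCat.mono_iff_injective _).1 h2

theorem stalkMap_surjective {F G : OMod E X} (f : F ⟶ G) [Epi f] (x : X) :
    Function.Surjective (OMod.stalkMap f x) := by
  have h1 : Epi ((SheafOfModules.toSheaf.{0} (ringSheaf E X)).map f) := toSheaf_map_epi _ f
  have h2 := @Functor.map_epi _ _ _ _ (TopCat.Sheaf.forget Ab (TopCat.of X) ⋙
    TopCat.Presheaf.stalkFunctor Ab (X := TopCat.of X) x) inferInstance _ _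
      ((SheafOfModules.toSheaf.{0} (ringSheaf E X)).map f) h1
  exact (AddCommGrpCat.epi_iff_surjective _).1 h2

theorem stalkMap_comp {F G H : OMod E X} (f : F ⟶ G) (g : G ⟶ H) (x : X) :
    OMod.stalkMap (f ≫ g) x = OMod.stalkMap g x ∘ₗ OMod.stalkMap f x :=
  LinearMap.ext fun s => by
    rw [LinearMap.comp_apply, stalkMap_apply_eq, stalkMap_apply_eq, stalkMap_apply_eq, Functor.map_comp]
    rfl

end
end HolConn
end

/-! ### The local ring of holomorphic germs, its derivations and its 1-forms. -/

noncomputable section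
namespace HolConn
open Filter

section
variable {E : Type} [NormedAddCommGroup E] [NormedSpace ℂ E]
variable {X : Type} [TopologicalSpace X] [ChartedSpace E X]

theorem fnGerm_eq_of_eventuallyEq {x : X} {U V : Opens X} (hU : x ∈ U) (hV : x ∈ V) (f : Sections E U)
    (g : Sections E V)
    (h : ∀ᶠ y in 𝓝 x, ∀ (h₁ : y ∈ U) (h₂ : y ∈ V), f ⟨y, h₁⟩ = g ⟨y, h₂⟩) :
    fnGerm E hU f = fnGerm E hV g := by
  obtain ⟨W, hW, hWo, hxW⟩ := eventually_nhds_iff.1 h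
  let W' : Opens X := ⟨W, hWo⟩ ⊓ U ⊓ V
  refine TopCat.Presheaf.germ_ext (structurePresheaf E X) W' ⟨⟨hxW, hU⟩, hV⟩
    (homOfLE fun y hy => hy.1.2) (homOfLE fun y hy => hy.2) ?_
  refine ContMDiffMap.ext fun y => ?_
  exact hW y.1 y.2.1.1 _ _

/-- Reduces identities in the abstract stalk to identities between functions on `E` near `coord E
x`, where calculus applies. -/
theorem toGerm_injective (x : X) : Function.Injective (toGerm (E := E) x) := by
  intro f g hfg
  obtain ⟨U, hU, f, rfl⟩ := f.exists_germ
  obtain ⟨V, hV, g, rfl⟩ := g.exists_germ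
  rw [toGerm_fnGerm, toGerm_fnGerm] at hfg
  have h : ∀ᶠ z in 𝓝 (coord E x), sectionInChart x f z = sectionInChart x g z := Germ.coe_eq.1 hfg
  have h1 := ((chartAt E x).continuousAt (mem_chart_source E x)).eventually h
  refine fnGerm_eq_of_eventuallyEq hU hV f g ?_
  filter_upwards [h1, (chartAt E x).open_source.mem_nhds (mem_chart_source E x)] with y hy hys hyU hyV
  have hy' : (chartAt E x).symm (chartAt E x y) = y := (chartAt E x).left_inv hys
  rw [sectionInChart_apply f (by rwa [hy']), sectionInChart_apply g (by rwa [hy'])] at hy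
  exact (congrArg (fun w : U => f w) (Subtype.ext hy'.symm)).trans
    (hy.trans (congrArg (fun w : V => g w) (Subtype.ext hy')))

variable [IsManifold 𝓘(ℂ, E) ∞ X]

/-- Pull `φ` back by the chart. Together with `exists_smooth_rep` and `toGerm_injective`, this
identifies the stalk with the germs of holomorphic functions on `E`, so that contractions and
derivatives computed in the chart define elements of the stalk. -/
theorem exists_toGerm_eq (x : X) {φ : E → ℂ} (hφ : SmoothNear φ (coord E x)) :
    ∃ f : LocalRing E x, toGerm x f = (φ : Germ (𝓝 (coord E x)) ℂ) := by
  obtain ⟨W, hW, hWo, hxW⟩ := eventually_nhds_iff.1 hφ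
  let U : Opens X := ⟨(chartAt E x).source ∩ chartAt E x ⁻¹' W,
    (chartAt E x).isOpen_inter_preimage hWo⟩
  have hU : x ∈ U := ⟨mem_chart_source E x, hxW⟩
  let f : Sections E U := (⟨fun y : U => φ (chartAt E x y.1), fun y => by
    refine contMDiffAt_subtype_iff (I := 𝓘(ℂ, E)) (I' := 𝓘(ℂ)) (U := U)
      (f := fun y : X => φ (chartAt E x y)) |>.2 ?_
    have h1 : ContMDiffAt 𝓘(ℂ, E) 𝓘(ℂ, E) ∞ (chartAt E x) y.1 :=
      contMDiffOn_chart.contMDiffAt ((chartAt E x).open_source.mem_nhds y.2.1)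
    exact (contMDiffAt_iff_contDiffAt.2 (hW _ y.2.2)).comp y.1 h1⟩ : C^∞⟮𝓘(ℂ, E), U; 𝓘(ℂ), ℂ⟯)
  refine ⟨fnGerm E hU f, (toGerm_fnGerm hU f).trans (Germ.coe_eq.2 ?_)⟩
  filter_upwards [eventually_mem hU,
    (chartAt E x).open_target.mem_nhds (mem_chart_target E x)] with z hz hzt
  rw [sectionInChart_apply f hz]
  change φ (chartAt E x ((chartAt E x).symm z)) = φ z
  rw [(chartAt E x).right_inv hzt]

theorem mem_maximalIdeal_iff {x : X} (f : LocalRing E x) :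
    f ∈ IsLocalRing.maximalIdeal (LocalRing E x) ↔ (toGerm x f).value = 0 := by
  rw [value_toGerm]
  have h := smoothSheafCommRing.nonunits_stalk 𝓘(ℂ, E) (M := X) x
  exact Set.ext_iff.1 h f

/-- Evaluation of germs of `1`-forms at a fixed vector. -/
def evalVec (x : X) (v : E) :
    Germ (𝓝 (coord E x)) (Form E 1) → Germ (𝓝 (coord E x)) ℂ := Germ.map fun θ => θ fun _ => v

theorem evalVec_add (x : X) (v : E) (γ δ : Germ (𝓝 (coord E x)) (Form E 1)) :
    evalVec x v (γ + δ) = evalVec x v γ + evalVec x v δ := by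
  induction γ using Germ.inductionOn
  induction δ using Germ.inductionOn
  rfl

theorem evalVec_smul (x : X) (v : E) (f : LocalRing E x) (γ : Germ (𝓝 (coord E x)) (Form E 1)) :
    evalVec x v (toGerm x f • γ) = toGerm x f * evalVec x v γ := by
  induction γ using Germ.inductionOn
  induction toGerm x f using Germ.inductionOn
  rfl

theorem exists_evalVec (x : X) (v : E) (γ : FormStalk E 1 x) :
    ∃ f : LocalRing E x, toGerm x f = evalVec x v γ.1 := by
  obtain ⟨_, θ, hθ, rfl⟩ := γ
  refine exists_toGerm_eq x (φ := fun z => θ z fun _ => v) ?_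
  filter_upwards [hθ] with w hw
  exact (ContinuousAlternatingMap.apply ℂ E ℂ fun _ => v).contDiff.contDiffAt.comp w hw

/-- The contraction of germs of `1`-forms with the constant vector field `v` in the preferred
chart. -/
def contract (x : X) (v : E) : FormStalk E 1 x →ₗ[LocalRing E x] LocalRing E x where
  toFun γ := (exists_evalVec x v γ).choose
  map_add' γ δ := toGerm_injective x <| by
    rw [map_add, (exists_evalVec x v (γ + δ)).choose_spec, (exists_evalVec x v γ).choose_spec,
      (exists_evalVec x v δ).choose_spec]
    exact evalVec_add x v γ.1 δ.1
  map_smul' f γ := toGerm_injective x <| by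
    rw [smul_eq_mul, map_mul, (exists_evalVec x v (f • γ)).choose_spec, RingHom.id_apply,
      (exists_evalVec x v γ).choose_spec]
    exact evalVec_smul x v f γ.1

theorem toGerm_contract (x : X) (v : E) (γ : FormStalk E 1 x) :
    toGerm x (contract x v γ) = evalVec x v γ.1 := (exists_evalVec x v γ).choose_spec

/-- The derivative of germs of functions along the constant vector field `v`. -/
def partialDeriv (x : X) (v : E) (f : LocalRing E x) : LocalRing E x :=
  contract x v (FormStalk.dFn x f)

theorem toGerm_partialDeriv (x : X) (v : E) (f : LocalRing E x) {φ : E → ℂ}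
    (h : toGerm x f = (φ : Germ (𝓝 (coord E x)) ℂ)) :
    toGerm x (partialDeriv x v f) = ((fun z => fderiv ℂ φ z v : E → ℂ) : Germ (𝓝 (coord E x)) ℂ) := by
  rw [partialDeriv, toGerm_contract]
  change evalVec x v (extDerivGerm
    (Germ.map (ContinuousAlternatingMap.constOfIsEmpty ℂ E (Fin 0)) (toGerm x f))) = _
  rw [h]
  refine Germ.coe_eq.2 (Eventually.of_forall fun z => ?_)
  change extDeriv (fun w => ContinuousAlternatingMap.constOfIsEmpty ℂ E (Fin 0) (φ w)) z _ = _
  rw [extDeriv_constOfIsEmpty]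
  rfl

theorem smoothNear_fderiv {φ : E → ℂ} {z : E} (hφ : SmoothNear φ z) (v : E) :
    SmoothNear (fun z => fderiv ℂ φ z v) z := by
  filter_upwards [hφ] with w hw
  exact (hw.fderiv_right (m := ∞) (by simp)).clm_apply contDiffAt_const

theorem partialDeriv_add (x : X) (v : E) (f g : LocalRing E x) :
    partialDeriv x v (f + g) = partialDeriv x v f + partialDeriv x v g := by
  obtain ⟨φ, hφ, h⟩ := exists_smooth_rep f
  obtain ⟨ψ, hψ, h'⟩ := exists_smooth_rep g
  have h2 : toGerm x (f + g) = ((φ + ψ : E → ℂ) : Germ (𝓝 (coord E x)) ℂ) := by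
    rw [map_add, h, h']; rfl
  refine toGerm_injective x ?_
  rw [map_add, toGerm_partialDeriv x v f h, toGerm_partialDeriv x v g h',
    toGerm_partialDeriv x v _ h2]
  refine Germ.coe_eq.2 ?_
  filter_upwards [hφ, hψ] with w h1 h2
  rw [fderiv_add (h1.differentiableAt (by simp)) (h2.differentiableAt (by simp))]
  rfl

theorem partialDeriv_mul (x : X) (v : E) (f g : LocalRing E x) :
    partialDeriv x v (f * g) = f * partialDeriv x v g + g * partialDeriv x v f := by
  obtain ⟨φ, hφ, h⟩ := exists_smooth_rep f
  obtain ⟨ψ, hψ, h'⟩ := exists_smooth_rep g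
  have h2 : toGerm x (f * g) = ((φ * ψ : E → ℂ) : Germ (𝓝 (coord E x)) ℂ) := by
    rw [map_mul, h, h']; rfl
  refine toGerm_injective x ?_
  rw [map_add, map_mul, map_mul, toGerm_partialDeriv x v f h, toGerm_partialDeriv x v g h',
    toGerm_partialDeriv x v _ h2, h, h']
  refine Germ.coe_eq.2 ?_
  filter_upwards [hφ, hψ] with w h1 h2
  rw [fderiv_mul (h1.differentiableAt (by simp)) (h2.differentiableAt (by simp))]
  rfl

/-- A germ of a holomorphic function all of whose iterated directional derivatives vanish at `x`
is zero. -/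
theorem eq_zero_of_iterated_partialDeriv {x : X} (f : LocalRing E x)
    (P : ℕ → LocalRing E x → Prop)
    (h0 : ∀ n f, P (n + 1) f → f ∈ IsLocalRing.maximalIdeal (LocalRing E x))
    (h1 : ∀ n f v, P (n + 1) f → P n (partialDeriv x v f)) (hf : ∀ n, P n f) : f = 0 := by
  -- Restricted to the complex line through `coord E x` in direction `v`, the derivative of order
  -- `n` at `0` is the value at `x` of the `n`-fold `partialDeriv x v`. Each derivative uses up one
  -- level of `P`, and the last level gives the vanishing of the value.
  have key : ∀ n (f : LocalRing E x) (φ : E → ℂ) (v : E), SmoothNear φ (coord E x) →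
      toGerm x f = (φ : Germ (𝓝 (coord E x)) ℂ) → P (n + 1) f →
      iteratedDeriv n (fun t : ℂ => φ (coord E x + t • v)) 0 = 0 := by
    intro n
    induction n with
    | zero =>
      intro f φ v _ h hP
      have := (mem_maximalIdeal_iff f).1 (h0 _ f hP)
      rw [h] at this
      simpa using this
    | succ n ih =>
      intro f φ v hφ h hP
      rw [iteratedDeriv_succ']
      refine Eq.trans ?_ (ih _ _ v (smoothNear_fderiv hφ v) (toGerm_partialDeriv x v f h) (h1 _ f v hP))
      apply EventuallyEq.iteratedDeriv_eq
      have hc : Tendsto (fun t : ℂ => coord E x + t • v) (𝓝 0) (𝓝 (coord E x)) := by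
        have hc0 : ContinuousAt (fun t : ℂ => coord E x + t • v) 0 := by fun_prop
        simpa [ContinuousAt] using hc0
      filter_upwards [hc.eventually hφ] with t ht
      have hl : HasDerivAt (fun t : ℂ => coord E x + t • v) v t := by
        simpa using ((hasDerivAt_id t).smul_const v).const_add (coord E x)
      exact ((ht.differentiableAt (by simp)).hasFDerivAt.comp_hasDerivAt t hl).deriv
  obtain ⟨φ, hφ, h⟩ := exists_smooth_rep f
  refine toGerm_injective x ?_
  rw [h, map_zero]
  obtain ⟨r, hr, hball⟩ := Metric.eventually_nhds_iff_ball.1 hφ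
  refine Germ.coe_eq.2 ?_
  filter_upwards [Metric.ball_mem_nhds _ hr] with z hz
  let v := z - coord E x
  have hv : ‖v‖ < r := by simpa [v, dist_eq_norm] using hz
  -- The parameter `t = 1` corresponds to `z` and must lie inside the open disc of convergence,
  -- hence a radius larger than `1` whose image stays in the ball. The one-variable Taylor series on
  -- this disc then gives `φ z = 0`.
  obtain ⟨ρ, hρ, hρv⟩ : ∃ ρ : ℝ, 1 < ρ ∧ ρ * ‖v‖ < r := by
    have : ∀ᶠ ρ : ℝ in 𝓝 1, ρ * ‖v‖ < r := by
      have hc : ContinuousAt (fun ρ : ℝ => ρ * ‖v‖) 1 := by fun_prop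
      exact hc.eventually_lt_const (by simpa using hv)
    obtain ⟨ε, hε, H⟩ := Metric.eventually_nhds_iff_ball.1 this
    refine ⟨1 + ε / 2, by linarith, H _ ?_⟩
    rw [Metric.mem_ball, Real.dist_eq]
    simp only [add_sub_cancel_left, abs_of_pos (half_pos hε)]
    linarith
  have hd : DifferentiableOn ℂ (fun t : ℂ => φ (coord E x + t • v)) (Metric.ball 0 ρ) := by
    intro t ht
    have : coord E x + t • v ∈ Metric.ball (coord E x) r := by
      rw [mem_ball_iff_norm, add_sub_cancel_left, norm_smul]
      have ht' : ‖t‖ < ρ := by simpa using ht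
      exact (mul_le_mul_of_nonneg_right ht'.le (norm_nonneg v)).trans_lt hρv
    have h2 := (hball _ this).differentiableAt (by simp)
    exact (h2.comp t (f := fun t : ℂ => coord E x + t • v) (by fun_prop)).differentiableWithinAt
  have hs := Complex.hasSum_taylorSeries_on_ball hd (z := 1) (by simpa using hρ)
  have hz' : coord E x + (1 : ℂ) • v = z := by simp [v]
  simp only [hz'] at hs
  refine hs.unique ?_
  convert hasSum_zero using 2 with n
  rw [key n f φ v hφ h (hf _)]
  simp

section basis
variable [FiniteDimensional ℂ E]
open Module

variable (E) in
/-- A basis of the model space. -/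
abbrev stdBasis : Basis (Fin (finrank ℂ E)) ℂ E := finBasis ℂ E

variable (E) in
/-- The coordinate `1`-forms. -/
def coordForm (j : Fin (finrank ℂ E)) : Form E 1 :=
  ContinuousAlternatingMap.ofSubsingleton ℂ E ℂ 0 ((stdBasis E).coord j).toContinuousLinearMap

theorem coordForm_apply (j : Fin (finrank ℂ E)) (u : Fin 1 → E) :
    coordForm E j u = (stdBasis E).repr (u 0) j := rfl

theorem form_eq_sum (θ : Form E 1) : θ = ∑ j, (θ fun _ => stdBasis E j) • coordForm E j := by
  ext u
  obtain ⟨w, rfl⟩ : ∃ w, u = fun _ => w := ⟨u 0, by ext i; fin_cases i; rfl⟩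
  have hθ (w : E) : θ (fun _ => w) =
      (ContinuousAlternatingMap.ofSubsingleton ℂ E ℂ (0 : Fin 1)).symm θ w := rfl
  rw [hθ]
  conv_lhs => rw [← (stdBasis E).sum_repr w]
  rw [map_sum, ContinuousAlternatingMap.sum_apply]
  refine Finset.sum_congr rfl fun j _ => ?_
  rw [map_smul, ContinuousAlternatingMap.smul_apply, coordForm_apply, hθ, smul_eq_mul, smul_eq_mul,
    mul_comm]

/-- The germs of the coordinate `1`-forms of the preferred chart at `x`. -/
def coordGerm (x : X) (j : Fin (finrank ℂ E)) : FormStalk E 1 x :=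
  ⟨((fun _ => coordForm E j : E → Form E 1) : Germ (𝓝 (coord E x)) (Form E 1)), _,
    Eventually.of_forall fun _ => contDiffAt_const, rfl⟩

theorem contract_coordGerm (x : X) (i j : Fin (finrank ℂ E)) :
    contract x (stdBasis E i) (coordGerm x j) = if i = j then 1 else 0 := by
  refine toGerm_injective x ?_
  rw [toGerm_contract]
  have h : evalVec x (stdBasis E i) (coordGerm x j).1 =
      ((fun _ => coordForm E j fun _ => stdBasis E i : E → ℂ) : Germ (𝓝 (coord E x)) ℂ) := rfl
  rw [h, coordForm_apply, Basis.repr_self, Finsupp.single_apply]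
  split_ifs
  · rw [map_one]; rfl
  · rw [map_zero]; rfl

theorem eq_of_evalVec (x : X) {γ δ : Germ (𝓝 (coord E x)) (Form E 1)}
    (h : ∀ j, evalVec x (stdBasis E j) γ = evalVec x (stdBasis E j) δ) : γ = δ := by
  induction γ using Germ.inductionOn with | _ θ
  induction δ using Germ.inductionOn with | _ η
  refine Germ.coe_eq.2 ?_
  have h' : ∀ j, ∀ᶠ z in 𝓝 (coord E x), θ z (fun _ => stdBasis E j) = η z (fun _ => stdBasis E j) :=
    fun j => Germ.coe_eq.1 (h j)
  filter_upwards [eventually_all.2 h'] with z hz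
  rw [form_eq_sum (θ z), form_eq_sum (η z)]
  simp only [hz]

theorem eq_of_contract (x : X) {γ δ : FormStalk E 1 x}
    (h : ∀ j, contract x (stdBasis E j) γ = contract x (stdBasis E j) δ) : γ = δ := by
  refine Subtype.ext (eq_of_evalVec x fun j => ?_)
  rw [← toGerm_contract, ← toGerm_contract, h]

theorem sum_contract_smul_coordGerm (x : X) (γ : FormStalk E 1 x) :
    ∑ j, contract x (stdBasis E j) γ • coordGerm x j = γ := by
  refine eq_of_contract x fun i => ?_
  rw [map_sum]
  simp only [map_smul, contract_coordGerm]
  simp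

/-- The coordinate `1`-forms are a basis of `Ω^1_x`. -/
def formBasis (x : X) : Basis (Fin (finrank ℂ E)) (LocalRing E x) (FormStalk E 1 x) :=
  Basis.ofEquivFun
    { toFun := fun γ j => contract x (stdBasis E j) γ
      invFun := fun f => ∑ j, f j • coordGerm x j
      map_add' := fun γ δ => by ext j; simp
      map_smul' := fun f γ => by ext j; simp
      left_inv := sum_contract_smul_coordGerm x
      right_inv := fun f => by
        ext i
        simp only [map_sum, map_smul, contract_coordGerm]
        simp }

/-- Freeness gives flatness of `Ω^1_x`, on which the restriction of connections to kernels rests. -/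
instance (x : X) : Module.Free (LocalRing E x) (FormStalk E 1 x) := .of_basis (formBasis x)
instance (x : X) : Module.Finite (LocalRing E x) (FormStalk E 1 x) := .of_basis (formBasis x)

end basis
end
end HolConn
end

/-! ### Algebra: freeness from derivations, additivity of traces, splittings. -/

noncomputable section
namespace HolConn

section Free
variable {R : Type*} [CommRing R] [IsLocalRing R] {ι : Type*} (D : ι → R →+ R)
  (hD : ∀ i f g, D i (f * g) = f * D i g + g * D i f)

include hD in
theorem derivation_mem_of_mul {I : Ideal R} {i : ι} {f g : R} (hg : g ∈ I) (h : D i g ∈ I) :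
    D i (f * g) ∈ I := by
  rw [hD]
  exact I.add_mem (I.mul_mem_left _ h) (I.mul_mem_right _ hg)

/-- The elements of order of vanishing at least `n`, with respect to a family of derivations of a
local ring. -/
def vanishingIdeal : ℕ → Ideal R
  | 0 => ⊤
  | n + 1 =>
    { carrier := {f | f ∈ IsLocalRing.maximalIdeal R ∧ f ∈ vanishingIdeal n ∧
        ∀ i, D i f ∈ vanishingIdeal n}
      add_mem' := fun hf hg => ⟨add_mem hf.1 hg.1, add_mem hf.2.1 hg.2.1, fun i => by
        rw [map_add]; exact add_mem (hf.2.2 i) (hg.2.2 i)⟩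
      zero_mem' := ⟨zero_mem _, zero_mem _, fun i => by rw [map_zero]; exact zero_mem _⟩
      smul_mem' := fun _ _ hg => ⟨Ideal.mul_mem_left _ _ hg.1, Ideal.mul_mem_left _ _ hg.2.1,
        fun i => derivation_mem_of_mul D hD hg.2.1 (hg.2.2 i)⟩ }

omit D hD in
/-- A finite module over a local ring has a generating family all of whose relations have
coefficients in the maximal ideal. -/
theorem exists_minimal_generators (M : Type*) [AddCommGroup M] [Module R M] [Module.Finite R M] :
    ∃ (k : ℕ) (e : Fin k → M), Submodule.span R (Set.range e) = ⊤ ∧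
      ∀ f : Fin k → R, ∑ i, f i • e i = 0 → ∀ j, f j ∈ IsLocalRing.maximalIdeal R := by
  classical
  have hex : ∃ k, ∃ e : Fin k → M, Submodule.span R (Set.range e) = ⊤ := Module.Finite.exists_fin
  obtain ⟨e, he⟩ := Nat.find_spec hex
  have hmin := fun m => Nat.find_min (m := m) hex
  generalize Nat.find hex = k at e he hmin
  refine ⟨k, e, he, fun f hf j => ?_⟩
  -- A unit among the coefficients would express `e j` through the other generators, against the
  -- minimality of `k`.
  by_contra hj
  have hu : IsUnit (f j) := by simpa using hj
  obtain _ | k := k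
  · exact j.elim0
  refine hmin k (Nat.lt_succ_self k) ⟨fun i => e (j.succAbove i), ?_⟩
  rw [eq_top_iff, ← he, Submodule.span_le]
  rintro _ ⟨i, rfl⟩
  rcases Fin.eq_self_or_eq_succAbove j i with rfl | ⟨i, rfl⟩
  · rw [Fin.sum_univ_succAbove _ i] at hf
    have h1 : f i • e i ∈ Submodule.span R (Set.range fun l => e (i.succAbove l)) := by
      rw [eq_neg_of_add_eq_zero_left hf]
      exact neg_mem (sum_mem fun l _ => Submodule.smul_mem _ _ (Submodule.subset_span ⟨l, rfl⟩))
    obtain ⟨a, ha⟩ := hu.exists_left_inv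
    have h2 := Submodule.smul_mem _ a h1
    rwa [smul_smul, ha, one_smul] at h2
  · exact Submodule.subset_span ⟨i, rfl⟩

/-- A finite module over a local ring with a separating family of derivations is free as soon as
the derivations lift to the module. -/
theorem free_of_derivations (hsep : ∀ f, (∀ n, f ∈ vanishingIdeal D hD n) → f = 0)
    {M : Type*} [AddCommGroup M] [Module R M] [Module.Finite R M] (N : ι → M →+ M)
    (hN : ∀ i (f : R) s, N i (f • s) = D i f • s + f • N i s) : Module.Free R M := by
  obtain ⟨k, e, he, hrel⟩ := exists_minimal_generators (R := R) M
  have hex : ∀ m : M, ∃ c : Fin k → R, ∑ i, c i • e i = m := fun m => by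
    have hm : m ∈ Submodule.span R (Set.range e) := by rw [he]; trivial
    exact (Submodule.mem_span_range_iff_exists_fun R).1 hm
  -- Write `N v (e i) = ∑ j, Γ i j • e j`. Applying `N v` to a relation `f` gives the relation with
  -- coefficients `D v (f j) + ∑ i, f i * Γ i j`. By induction these and the `f i` have order at
  -- least `n`, hence so does `D v (f j)`. Thus every relation vanishes to infinite order.
  have key : ∀ n (f : Fin k → R), ∑ i, f i • e i = 0 → ∀ j, f j ∈ vanishingIdeal D hD n := by
    intro n
    induction n with
    | zero => intro f _ j; trivial
    | succ n ih =>
      intro f hf j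
      refine ⟨hrel f hf j, ih f hf j, fun v => ?_⟩
      choose Γ hΓ using fun i => hex (N v (e i))
      have h1 : ∑ j, (D v (f j) + ∑ i, f i * Γ i j) • e j = 0 := by
        have h0 : N v (∑ i, f i • e i) = 0 := by rw [hf, map_zero]
        rw [map_sum] at h0
        rw [← h0]
        simp only [add_smul, Finset.sum_add_distrib, hN, Finset.sum_smul, mul_smul, ← hΓ,
          Finset.smul_sum]
        rw [Finset.sum_comm (s := Finset.univ) (t := Finset.univ) (f := fun x i => f i • Γ i x • e x)]
      have h2 := ih _ h1 j
      refine (Ideal.add_mem_iff_left _ ?_).1 h2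
      exact sum_mem fun i _ => Ideal.mul_mem_right _ _ (ih f hf i)
  have hli : LinearIndependent R e :=
    Fintype.linearIndependent_iff.2 fun f hf i => hsep _ fun n => key n f hf i
  exact Module.Free.of_basis (Module.Basis.mk hli he.ge)

end Free

section Trace
variable {k : Type*} [Field k] {U V W : Type*} [AddCommGroup U] [AddCommGroup V] [AddCommGroup W]
  [Module k U] [Module k V] [Module k W] [FiniteDimensional k U] [FiniteDimensional k V]
  [FiniteDimensional k W]

/-- The trace is additive in split short exact sequences with compatible endomorphisms. -/
theorem trace_eq_add_of_split {f : U →ₗ[k] V} {g : V →ₗ[k] W} {r : V →ₗ[k] U} {s : W →ₗ[k] V}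
    (hrf : r ∘ₗ f = LinearMap.id) (hgs : g ∘ₗ s = LinearMap.id)
    (hfs : f ∘ₗ r + s ∘ₗ g = LinearMap.id) {a : U →ₗ[k] U} {b : V →ₗ[k] V} {c : W →ₗ[k] W}
    (hf : b ∘ₗ f = f ∘ₗ a) (hg : g ∘ₗ b = c ∘ₗ g) :
    LinearMap.trace k V b = LinearMap.trace k U a + LinearMap.trace k W c := by
  -- Cyclicity of the trace moves `r` and `g` to the left, leaving `r ∘ₗ f ∘ₗ a = a` and `g ∘ₗ b ∘ₗ
  -- s = c`.
  have h1 : b = (f ∘ₗ a) ∘ₗ r + (b ∘ₗ s) ∘ₗ g := by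
    rw [← hf, LinearMap.comp_assoc, LinearMap.comp_assoc, ← LinearMap.comp_add, hfs,
      LinearMap.comp_id]
  have h2 : r ∘ₗ f ∘ₗ a = a := by rw [← LinearMap.comp_assoc, hrf, LinearMap.id_comp]
  have h3 : g ∘ₗ b ∘ₗ s = c := by
    rw [← LinearMap.comp_assoc, hg, LinearMap.comp_assoc, hgs, LinearMap.comp_id]
  conv_lhs => rw [h1]
  rw [map_add, LinearMap.trace_comp_comm' r, LinearMap.trace_comp_comm' g, h2, h3]

end Trace

section Split
variable {R : Type*} [CommRing R] {M N P : Type*} [AddCommGroup M] [AddCommGroup N]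
  [AddCommGroup P] [Module R M] [Module R N] [Module R P]

/-- Lift the identity of `P` to a section `s`; the retraction is `n - s (g n)` read in `M`. The
splitting is recorded by equations between maps because these survive the base change to the fibre,
which injectivity of `f` alone need not do. -/
theorem exists_splitting [Module.Projective R P] {f : M →ₗ[R] N} {g : N →ₗ[R] P}
    (hf : Function.Injective f) (hfg : Function.Exact f g) (hg : Function.Surjective g) :
    ∃ (r : N →ₗ[R] M) (s : P →ₗ[R] N), r ∘ₗ f = LinearMap.id ∧ g ∘ₗ s = LinearMap.id ∧
      f ∘ₗ r + s ∘ₗ g = LinearMap.id := by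
  obtain ⟨s, hs⟩ := Module.projective_lifting_property g LinearMap.id hg
  have hs' : ∀ p, g (s p) = p := fun p => LinearMap.congr_fun hs p
  have hker : ∀ n, n - s (g n) ∈ LinearMap.range f := fun n => by
    refine (hfg _).1 ?_
    rw [map_sub, hs', sub_self]
  let e := LinearEquiv.ofInjective f hf
  let q : N →ₗ[R] LinearMap.range f := (LinearMap.id - s ∘ₗ g).codRestrict _ hker
  have hfe : ∀ y, f (e.symm y) = y := fun y => congrArg Subtype.val (e.apply_symm_apply y)
  have hfr : ∀ n, f (e.symm (q n)) = n - s (g n) := fun n => hfe _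
  refine ⟨e.symm.toLinearMap ∘ₗ q, s, ?_, hs, ?_⟩
  · ext m
    refine hf ((hfr (f m)).trans ?_)
    rw [hfg.apply_apply_eq_zero, map_zero, sub_zero]
    rfl
  · ext n
    exact (congrArg (· + s (g n)) (hfr n)).trans (sub_add_cancel _ _)

end Split

/-! ### Connections on modules over the local ring, and their curvature on the fibre. -/

variable {E : Type} [NormedAddCommGroup E] [NormedSpace ℂ E]
variable {X : Type} [TopologicalSpace X] [ChartedSpace E X] [IsManifold 𝓘(ℂ, E) ∞ X]

variable (E) in
/-- A connection on a module over the local ring `𝒪_{X,x}`. -/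
structure StalkConnection {X : Type} [TopologicalSpace X] [ChartedSpace E X] [IsManifold 𝓘(ℂ, E) ∞ X] (x : X) (M : Type) [AddCommGroup M] [Module (LocalRing E x) M] where
  toFun : M →+ FormStalk E 1 x ⊗[LocalRing E x] M
  leibniz (f : LocalRing E x) (s : M) : toFun (f • s) = FormStalk.dFn x f ⊗ₜ s + f • toFun s

namespace StalkConnection
variable {x : X} {M N P : Type} [AddCommGroup M] [Module (LocalRing E x) M]
  [AddCommGroup N] [Module (LocalRing E x) N] [AddCommGroup P] [Module (LocalRing E x) P]

instance instAddCommGroupFormTensor (p : ℕ) : AddCommGroup (FormStalk E p x ⊗[LocalRing E x] M) :=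
  TensorProduct.addCommGroup (R := LocalRing E x) (M := FormStalk E p x) (N := M)

/-- A finite `𝒪_{X,x}`-module with a connection is free. -/
theorem free (α : StalkConnection E x M) [Module.Finite (LocalRing E x) M] :
    Module.Free (LocalRing E x) M := by
  let D : E → LocalRing E x →+ LocalRing E x := fun v =>
    AddMonoidHom.mk' (partialDeriv x v) (partialDeriv_add x v)
  have hD : ∀ v f g, D v (f * g) = f * D v g + g * D v f := partialDeriv_mul x
  -- The covariant derivative along the constant vector field `v` of the chart; it lifts the
  -- derivation `partialDeriv x v`.
  let N : E → M →+ M := fun v =>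
    ((TensorProduct.lid _ M).toLinearMap ∘ₗ (contract x v).rTensor M).toAddMonoidHom.comp α.toFun
  refine free_of_derivations D hD (fun f hf => ?_) N fun v f s => ?_
  · refine eq_zero_of_iterated_partialDeriv f (fun n f => f ∈ vanishingIdeal D hD n)
      (fun n f h => h.1) (fun n f v h => h.2.2 v) hf
  · change TensorProduct.lid _ M ((contract x v).rTensor M (α.toFun (f • s))) = _ • s + f •
      TensorProduct.lid _ M ((contract x v).rTensor M (α.toFun s))
    rw [α.leibniz, map_add, map_add, map_smul, map_smul, LinearMap.rTensor_tmul,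
      TensorProduct.lid_tmul]
    rfl

/-- Compatibility of a linear map with connections. -/
def Compatible (φ : M →ₗ[LocalRing E x] N) (α : StalkConnection E x M) (β : StalkConnection E x N) :
    Prop := ∀ s, φ.lTensor (FormStalk E 1 x) (α.toFun s) = β.toFun (φ s)

/-- The extension `Ω^1 ⊗ M → Ω^2 ⊗ M` of a connection. -/
def ext1 (α : StalkConnection E x M) : FormStalk E 1 x ⊗[LocalRing E x] M →+
    FormStalk E 2 x ⊗[LocalRing E x] M :=
  TensorProduct.liftAddHom
    (AddMonoidHom.mk' (fun θ => AddMonoidHom.mk' (fun s => FormStalk.d₁ x θ ⊗ₜ[LocalRing E x] s -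
        (FormStalk.wedge x θ).rTensor M (α.toFun s))
      (fun s t => by
        simp only [TensorProduct.tmul_add, map_add]; abel))
      (fun θ η => by
        refine AddMonoidHom.ext fun s => ?_
        simp only [map_add, TensorProduct.add_tmul, LinearMap.rTensor_add, LinearMap.add_apply,
          AddMonoidHom.mk'_apply, AddMonoidHom.add_apply]
        abel))
    (fun f θ s => by
      simp only [AddMonoidHom.mk'_apply, FormStalk.d₁_smul, α.leibniz, map_add, map_smul,
        LinearMap.rTensor_tmul, TensorProduct.add_tmul, TensorProduct.smul_tmul',
        LinearMap.rTensor_smul, LinearMap.smul_apply, TensorProduct.tmul_smul]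
      rw [FormStalk.wedge_comm x (FormStalk.dFn x f) θ,
        TensorProduct.neg_tmul (R := LocalRing E x) (M := FormStalk E 2 x) (N := M)]
      abel)

theorem ext1_tmul (α : StalkConnection E x M) (θ : FormStalk E 1 x) (s : M) :
    α.ext1 (θ ⊗ₜ s) =
      FormStalk.d₁ x θ ⊗ₜ s - (FormStalk.wedge x θ).rTensor M (α.toFun s) := rfl

theorem ext1_smul (α : StalkConnection E x M) (f : LocalRing E x)
    (t : FormStalk E 1 x ⊗[LocalRing E x] M) :
    α.ext1 (f • t) =
      (FormStalk.wedge x (FormStalk.dFn x f)).rTensor M t + f • α.ext1 t := by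
  induction t using TensorProduct.induction_on with
  | zero => simp
  | add s t hs ht => rw [smul_add, map_add, hs, ht, map_add, map_add, smul_add]; abel
  | tmul θ s =>
    rw [TensorProduct.smul_tmul', ext1_tmul, ext1_tmul, FormStalk.d₁_smul, map_smul,
      LinearMap.rTensor_smul, LinearMap.smul_apply, LinearMap.rTensor_tmul, TensorProduct.add_tmul,
      smul_sub, TensorProduct.smul_tmul']
    abel

/-- The curvature of a connection. -/
def curvature (α : StalkConnection E x M) :
    M →ₗ[LocalRing E x] FormStalk E 2 x ⊗[LocalRing E x] M where
  toFun s := α.ext1 (α.toFun s)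
  map_add' s t := by rw [map_add, map_add]
  map_smul' f s := by
    rw [α.leibniz, map_add, ext1_tmul, ext1_smul, FormStalk.d₁_dFn, TensorProduct.zero_tmul]
    simp

/-- On `θ ⊗ s`, the map `φ` acts on the second tensor factor while `dθ` and the exterior product
with `θ` act on the first, so the operations commute. -/
theorem Compatible.ext1 {φ : M →ₗ[LocalRing E x] N} {α : StalkConnection E x M}
    {β : StalkConnection E x N} (h : Compatible φ α β) (t : FormStalk E 1 x ⊗[LocalRing E x] M) :
    φ.lTensor (FormStalk E 2 x) (α.ext1 t) = β.ext1 (φ.lTensor (FormStalk E 1 x) t) := by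
  induction t using TensorProduct.induction_on with
  | zero => simp
  | add s t hs ht => simp only [map_add, hs, ht]
  | tmul θ s =>
    rw [ext1_tmul, LinearMap.lTensor_tmul, ext1_tmul, map_sub, LinearMap.lTensor_tmul, ← h s]
    congr 1
    exact LinearMap.congr_fun ((LinearMap.lTensor_comp_rTensor _ _ _).trans
      (LinearMap.rTensor_comp_lTensor _ _ _).symm) _

theorem Compatible.curvature {φ : M →ₗ[LocalRing E x] N} {α : StalkConnection E x M}
    {β : StalkConnection E x N} (h : Compatible φ α β) (s : M) :
    φ.lTensor (FormStalk E 2 x) (α.curvature s) = β.curvature (φ s) :=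
  (h.ext1 _).trans (congrArg β.ext1 (h s))

/-- The value of the curvature on a pair of tangent vectors, as an endomorphism of the fibre. -/
def fiberCurvature (α : StalkConnection E x M) (u : Fin 2 → E) :
    Module.End ℂ (ℂ ⊗[LocalRing E x] M) :=
  ((FormStalk.eval x u).rTensor M ∘ₗ α.curvature).liftBaseChange ℂ

theorem Compatible.fiberCurvature {φ : M →ₗ[LocalRing E x] N} {α : StalkConnection E x M}
    {β : StalkConnection E x N} (h : Compatible φ α β) (u : Fin 2 → E) :
    φ.baseChange ℂ ∘ₗ α.fiberCurvature u = β.fiberCurvature u ∘ₗ φ.baseChange ℂ := by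
  refine LinearMap.ext fun t => ?_
  induction t using TensorProduct.induction_on with
  | zero => simp
  | add s t hs ht => simp only [map_add, hs, ht]
  | tmul c s =>
    rw [LinearMap.comp_apply, LinearMap.comp_apply, LinearMap.baseChange_tmul,
      StalkConnection.fiberCurvature, StalkConnection.fiberCurvature,
      LinearMap.liftBaseChange_tmul, LinearMap.liftBaseChange_tmul, map_smul]
    congr 1
    rw [LinearMap.comp_apply, LinearMap.comp_apply, ← h.curvature]
    exact LinearMap.congr_fun ((LinearMap.lTensor_comp_rTensor _ _ _).trans
      (LinearMap.rTensor_comp_lTensor _ _ _).symm) _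

/-- The pairing `tr(K(u) K(v))`. -/
def tracePairing (α : StalkConnection E x M) (u v : Fin 2 → E) : ℂ :=
  LinearMap.trace ℂ (ℂ ⊗[LocalRing E x] M) (α.fiberCurvature u * α.fiberCurvature v)

/-- Additivity of `tr(K(u) K(v))` in short exact sequences with free quotient. -/
theorem tracePairing_eq_add {f : M →ₗ[LocalRing E x] N} {g : N →ₗ[LocalRing E x] P}
    (hf : Function.Injective f) (hfg : Function.Exact f g) (hg : Function.Surjective g)
    [Module.Free (LocalRing E x) P] [Module.Finite (LocalRing E x) N]
    {α : StalkConnection E x M} {β : StalkConnection E x N} {γ : StalkConnection E x P}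
    (hαβ : Compatible f α β) (hβγ : Compatible g β γ) (u v : Fin 2 → E) :
    β.tracePairing u v = α.tracePairing u v + γ.tracePairing u v := by
  obtain ⟨r, s, hrf, hgs, hfs⟩ := exists_splitting hf hfg hg
  -- `M` is a quotient of `N` through the retraction, hence finite; all three fibres are then finite
  -- dimensional, as the trace formula requires.
  have hr : Function.Surjective r := fun m => ⟨f m, LinearMap.congr_fun hrf m⟩
  have : Module.Finite (LocalRing E x) M := Module.Finite.of_surjective r hr
  have : Module.Finite (LocalRing E x) P := Module.Finite.of_surjective g hg
  refine trace_eq_add_of_split (f := f.baseChange ℂ) (g := g.baseChange ℂ) (r := r.baseChange ℂ)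
    (s := s.baseChange ℂ) ?_ ?_ ?_ ?_ ?_
  · rw [← LinearMap.baseChange_comp, hrf, LinearMap.baseChange_id]
  · rw [← LinearMap.baseChange_comp, hgs, LinearMap.baseChange_id]
  · rw [← LinearMap.baseChange_comp, ← LinearMap.baseChange_comp, ← LinearMap.baseChange_add, hfs,
      LinearMap.baseChange_id]
  · rw [Module.End.mul_eq_comp, LinearMap.comp_assoc, ← hαβ.fiberCurvature, ← LinearMap.comp_assoc,
      ← hαβ.fiberCurvature]
    rfl
  · rw [Module.End.mul_eq_comp, ← LinearMap.comp_assoc, hβγ.fiberCurvature, LinearMap.comp_assoc,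
      hβγ.fiberCurvature]
    rfl

/-- A connection descends along a surjective map whose kernel it respects. -/
theorem exists_of_surjective {φ : M →ₗ[LocalRing E x] N} (hφ : Function.Surjective φ)
    (α : StalkConnection E x M)
    (h : ∀ s, φ s = 0 → φ.lTensor (FormStalk E 1 x) (α.toFun s) = 0) :
    ∃ β : StalkConnection E x N, Compatible φ α β := by
  let ψ : M →+ FormStalk E 1 x ⊗[LocalRing E x] N :=
    (φ.lTensor (FormStalk E 1 x)).toAddMonoidHom.comp α.toFun
  have hψ : ∀ s t, φ s = φ t → ψ s = ψ t := fun s t hst => by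
    rw [← sub_eq_zero, ← map_sub]
    exact h _ (by rw [map_sub, hst, sub_self])
  -- A set-theoretic section suffices: by `hψ` the value of `ψ` does not depend on the chosen
  -- preimage, so additivity and the Leibniz rule pass to the quotient.
  let σ := Function.surjInv hφ
  have hσ : ∀ s, φ (σ s) = s := Function.surjInv_eq hφ
  refine ⟨⟨AddMonoidHom.mk' (fun s => ψ (σ s)) fun s t => ?_, fun f s => ?_⟩, fun s => ?_⟩
  · rw [← map_add]
    exact hψ _ _ (by rw [map_add, hσ, hσ, hσ])
  · have h1 : ψ (σ (f • s)) = ψ (f • σ s) := hψ _ _ (by rw [map_smul, hσ, hσ])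
    have h2 : ψ (f • σ s) = φ.lTensor (FormStalk E 1 x) (α.toFun (f • σ s)) := rfl
    rw [AddMonoidHom.mk'_apply, h1, h2, α.leibniz, map_add,
      LinearMap.lTensor_tmul, hσ, map_smul]
    rfl
  · exact hψ _ _ (hσ _).symm

/-- A connection restricts to a submodule it respects. -/
theorem exists_of_injective {φ : M →ₗ[LocalRing E x] N}
    (hφ : Function.Injective (φ.lTensor (FormStalk E 1 x))) (β : StalkConnection E x N)
    (h : ∀ s, ∃ t, φ.lTensor (FormStalk E 1 x) t = β.toFun (φ s)) :
    ∃ α : StalkConnection E x M, Compatible φ α β := by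
  choose ψ hψ using h
  refine ⟨⟨AddMonoidHom.mk' ψ fun s t => hφ ?_, fun f s => hφ ?_⟩, hψ⟩
  · simp only [map_add, hψ]
  · simp only [AddMonoidHom.mk'_apply, map_add, hψ, map_smul, β.leibniz, LinearMap.lTensor_tmul]

end StalkConnection

namespace Connection
variable {F G : OMod E X}

/-- The connection on the stalk at `x`. -/
def atStalk (α : Connection F) (x : X) : StalkConnection E x (F.Stalk x) :=
  ⟨α.toFun x, α.leibniz x⟩

theorem Compatible.atStalk {f : F ⟶ G} {α : Connection F} {β : Connection G}
    (h : Compatible f α β) (x : X) :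
    StalkConnection.Compatible (OMod.stalkMap f x) (α.atStalk x) (β.atStalk x) := h x

theorem atStalk_tracePairing (α : Connection F) (x : X) (u v : Fin 2 → E) :
    (α.atStalk x).tracePairing u v =
      LinearMap.trace ℂ (F.Fiber x) (α.curvatureAt x u * α.curvatureAt x v) := rfl

end Connection
end HolConn
end

/-! ### The form tr(K ∧ ⋆K) in terms of the traces tr(K(u)K(v)). -/

noncomputable section
namespace HolConn
open Module

section
open scoped Nat

theorem alternatingMap_sum_apply {R V W ι κ : Type*} [CommSemiring R] [AddCommMonoid V] [Module R V]
    [AddCommMonoid W] [Module R W] (s : Finset κ) (f : κ → V [⋀^ι]→ₗ[R] W) (v : ι → V) :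
    (∑ k ∈ s, f k) v = ∑ k ∈ s, f k v :=
  map_sum ({ toFun := fun a => a v, map_zero' := rfl, map_add' := fun _ _ => rfl } :
    (V [⋀^ι]→ₗ[R] W) →+ W) f s

theorem hodgeStar_apply {V W : Type*} [NormedAddCommGroup V] [InnerProductSpace ℝ V]
    [FiniteDimensional ℝ V] [AddCommGroup W] [Module ℝ W] {N p q : ℕ} [Fact (finrank ℝ V = N)]
    (o : Orientation ℝ V (Fin N)) (h : p + q = N) (β : V [⋀^Fin p]→ₗ[ℝ] W) (v : Fin q → V) :
    hodgeStar o h β v = ∑ a : Fin p → Fin (finrank ℝ V), ((p ! : ℝ)⁻¹ *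
      plug (o.volumeForm.domDomCongr (finSumFinEquiv.trans (finCongr h)).symm)
        (stdOrthonormalBasis ℝ V ∘ a) v) • β (stdOrthonormalBasis ℝ V ∘ a) := by
  rw [hodgeStar, AlternatingMap.smul_apply, alternatingMap_sum_apply, Finset.smul_sum]
  simp only [mul_smul]
  rfl

theorem wedgeMul_apply {V A : Type*} [AddCommGroup V] [Module ℝ V] [Ring A] [Algebra ℝ A]
    {p q : ℕ} (a : V [⋀^Fin p]→ₗ[ℝ] A) (b : V [⋀^Fin q]→ₗ[ℝ] A) (v : Fin (p + q) → V) :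
    wedgeMul a b v = ∑ σ : Equiv.Perm.ModSumCongr (Fin p) (Fin q), (Equiv.Perm.sign σ.out : ℤ) •
      (a (fun i => v (finSumFinEquiv (σ.out (Sum.inl i)))) *
        b (fun i => v (finSumFinEquiv (σ.out (Sum.inr i))))) := by
  have h : wedgeMul a b v = LinearMap.mul' ℝ A
      (a.domCoprod b fun i => v (finSumFinEquiv i)) := rfl
  rw [h, AlternatingMap.domCoprod_apply, _root_.sum_apply, map_sum]
  refine Finset.sum_congr rfl fun σ _ => ?_
  conv_lhs => rw [← Quotient.out_eq' σ]
  rw [AlternatingMap.domCoprod.summand_mk'', _root_.smul_apply, Units.smul_def, map_zsmul]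
  rfl

end

variable {E : Type} [NormedAddCommGroup E] [NormedSpace ℂ E] [FiniteDimensional ℂ E]
variable {X : Type} [TopologicalSpace X] [ChartedSpace E X] [IsManifold 𝓘(ℂ, E) ∞ X]

open scoped Bundle in
-- The order of the quantifiers is the point: the coefficients and the argument vectors come from
-- the metric alone, so the same ones serve the endomorphism algebras of all sheaves.
theorem KahlerMetric.exists_star_eq_sum (g : KahlerMetric E X) (x : X) {p q : ℕ}
    (h : p + q = finrank ℂ E * 2) :
    ∃ (ι : Type) (_ : Fintype ι) (c : (Fin q → E) → ι → ℝ) (e : ι → Fin p → E),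
      ∀ (W : Type) [AddCommGroup W] [Module ℝ W] (β : E [⋀^Fin p]→ₗ[ℝ] W) (v : Fin q → E),
        g.star x h β v = ∑ i, c v i • β (e i) := by
  let _ : Bundle.RiemannianBundle (fun x : X => TangentSpace 𝓘(ℝ, E) x) :=
    ⟨g.metric.toRiemannianMetric⟩
  let _ : FiniteDimensional ℝ (TangentSpace 𝓘(ℝ, E) x) :=
    inferInstanceAs (FiniteDimensional ℝ E)
  let _ : Fact (finrank ℝ (TangentSpace 𝓘(ℝ, E) x) = finrank ℂ E * 2) :=
    ⟨finrank_real (E := E)⟩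
  exact ⟨_, inferInstance, _, _, fun W _ _ β v =>
    hodgeStar_apply (V := TangentSpace 𝓘(ℝ, E) x) (complexOrientation E) h β v⟩

/-- The form `tr(K ∧ ⋆K)` is a universal linear combination of the numbers `tr(K(u) K(v))`. -/
theorem exists_Phi_eq_sum (g : KahlerMetric E X) (x : X) (v : Fin (finrank ℂ E * 2) → E) :
    ∃ (ι : Type) (_ : Fintype ι) (c : ι → ℂ) (u w : ι → Fin 2 → E),
      ∀ (F : OMod E X) (α : Connection F),
        Phi g α x v = ∑ i, c i * (α.atStalk x).tracePairing (u i) (w i) := by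
  by_cases h : 2 + (finrank ℂ E * 2 - 2) = finrank ℂ E * 2
  · obtain ⟨κ, _, c, e, hs⟩ := g.exists_star_eq_sum x h
    -- One index for the shuffle in the exterior product and one for the term of the Hodge star. The
    -- coefficients combine the sign of the shuffle with the coefficient of the star.
    refine ⟨Equiv.Perm.ModSumCongr (Fin 2) (Fin (finrank ℂ E * 2 - 2)) × κ, inferInstance,
      fun i => ((Equiv.Perm.sign i.1.out : ℤ) : ℂ) *
        (c (fun j => v (finCongr h (finSumFinEquiv (i.1.out (Sum.inr j))))) i.2 : ℂ),
      fun i j => v (finCongr h (finSumFinEquiv (i.1.out (Sum.inl j)))),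
      fun i => e i.2, fun F α => ?_⟩
    have h1 : Phi g α x v = LinearMap.trace ℂ (F.Fiber x)
        (wedgeMul (α.realCurvatureAt x) (g.star x h (α.realCurvatureAt x))
          (fun j => v (finCongr h j))) := by
      rw [Phi, dif_pos h]; rfl
    rw [Fintype.sum_prod_type]
    refine h1.trans ((congrArg (LinearMap.trace ℂ (F.Fiber x)) (wedgeMul_apply
      (A := Module.End ℂ (F.Fiber x)) _ _ _)).trans ?_)
    rw [map_sum]
    refine Finset.sum_congr rfl fun σ _ => ?_
    have h2 := hs (Module.End ℂ (F.Fiber x)) (α.realCurvatureAt x)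
      (fun j => v (finCongr h (finSumFinEquiv (σ.out (Sum.inr j)))))
    refine (congrArg (fun t => LinearMap.trace ℂ (F.Fiber x) ((Equiv.Perm.sign σ.out : ℤ) •
      (α.realCurvatureAt x (fun j => v (finCongr h (finSumFinEquiv (σ.out (Sum.inl j))))) * t)))
        h2).trans ?_
    simp only
    rw [map_zsmul, Finset.mul_sum, map_sum, Finset.smul_sum]
    refine Finset.sum_congr rfl fun i _ => ?_
    rw [mul_smul_comm, Connection.atStalk_tracePairing, zsmul_eq_mul, mul_assoc]
    congr 1
    exact (LinearMap.trace ℂ (F.Fiber x)).map_smul_of_tower _ _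
  -- With truncated subtraction, `h` fails exactly in complex dimension `0`, where `Phi` is `0` by
  -- definition and the empty sum represents it.
  · exact ⟨Empty, inferInstance, nofun, nofun, nofun, fun F α => by
      rw [Phi, dif_neg h]; simp⟩

theorem Phi_eq_add (g : KahlerMetric E X) (x : X) {A B C : OMod E X} {α : Connection A}
    {β : Connection B} {γ : Connection C}
    (h : ∀ u v, (β.atStalk x).tracePairing u v =
      (α.atStalk x).tracePairing u v + (γ.atStalk x).tracePairing u v) :
    Phi g β x = Phi g α x + Phi g γ x := by
  ext v
  obtain ⟨ι, _, c, u, w, hΦ⟩ := exists_Phi_eq_sum g x v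
  rw [AlternatingMap.add_apply, hΦ, hΦ, hΦ, ← Finset.sum_add_distrib]
  exact Finset.sum_congr rfl fun i _ => by rw [h, mul_add]

theorem sum_Phi_eq (g : KahlerMetric E X) (x : X) {F G : ℤ → OMod E X}
    (α : ∀ i, Connection (F i)) (β : ∀ i, Connection (G i)) (s : Finset ℤ)
    (h : ∀ u v, ∑ i ∈ s, i.negOnePow • ((α i).atStalk x).tracePairing u v =
      ∑ i ∈ s, i.negOnePow • ((β i).atStalk x).tracePairing u v) :
    ∑ i ∈ s, i.negOnePow • Phi g (α i) x = ∑ i ∈ s, i.negOnePow • Phi g (β i) x := by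
  ext v
  obtain ⟨ι, _, c, u, w, hΦ⟩ := exists_Phi_eq_sum g x v
  have key : ∀ {H : ℤ → OMod E X} (δ : ∀ i, Connection (H i)),
      (∑ i ∈ s, i.negOnePow • Phi g (δ i) x) v =
        ∑ k, c k * ∑ i ∈ s, i.negOnePow • ((δ i).atStalk x).tracePairing (u k) (w k) := by
    intro H δ
    simp only [alternatingMap_sum_apply, AlternatingMap.smul_apply, hΦ, Finset.smul_sum,
      Finset.mul_sum, mul_smul_comm]
    exact Finset.sum_comm
  rw [key, key]
  simp only [h]

end HolConn
end

/-! ### Coordinate frames for holomorphic 1-forms on neighbourhoods. -/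

noncomputable section
namespace HolConn
open Filter

section
variable {E : Type} [NormedAddCommGroup E] [NormedSpace ℂ E]
variable {X : Type} [TopologicalSpace X] [ChartedSpace E X]

namespace OMod
variable {F G : OMod E X}

/-- Restriction of sections. -/
def res (F : OMod E X) {U V : Opens X} (h : V ≤ U) (s : F.Sec U) : F.Sec V :=
  F.pre.presheaf.map (homOfLE h).op s

theorem germ_res {U V : Opens X} (h : V ≤ U) {x : X} (hV : x ∈ V) (s : F.Sec U) :
    F.germ hV (F.res h s) = F.germ (h hV) s :=
  TopCat.Presheaf.germ_res_apply (X := TopCat.of X) F.pre.presheaf (homOfLE h) x hV s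

/-- Spreads an identity of germs at one point to all nearby points, as the local description of a
connection demands. -/
theorem exists_germ_eqOn {U V : Opens X} {x : X} (hU : x ∈ U) (hV : x ∈ V) {s : F.Sec U}
    {t : F.Sec V} (h : F.germ hU s = F.germ hV t) :
    ∀ᶠ y in 𝓝 x, ∃ (h₁ : y ∈ U) (h₂ : y ∈ V), F.germ h₁ s = F.germ h₂ t := by
  obtain ⟨W, hW, iU, iV, hst⟩ :=
    TopCat.Presheaf.germ_eq (X := TopCat.of X) F.pre.presheaf x hU hV s t h
  filter_upwards [W.isOpen.mem_nhds hW] with y hy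
  refine ⟨leOfHom iU hy, leOfHom iV hy, ?_⟩
  rw [← germ_res (leOfHom iU) hy, ← germ_res (leOfHom iV) hy]
  exact congrArg (F.germ hy) hst

theorem exists_stalkMap_germ (f : F ⟶ G) {U : Opens X} (s : F.Sec U) :
    ∃ t : G.Sec U, ∀ (x : X) (hx : x ∈ U), stalkMap f x (F.germ hx s) = G.germ hx t :=
  ⟨f.val.app (op U) s, fun _ hx => stalkMapAdd_germ f hx s⟩

end OMod

theorem fnGerm_res {U V : Opens X} (h : V ≤ U) {x : X} (hV : x ∈ V) (f : Sections E U) :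
    fnGerm E hV ((structurePresheaf E X).map (homOfLE h).op f) = fnGerm E (h hV) f :=
  (structurePresheaf E X).germ_res_apply (homOfLE h) x hV f

theorem exists_opens_of_eventually {x : X} {U : Opens X} (hx : x ∈ U) {P : X → Prop}
    (h : ∀ᶠ y in 𝓝 x, P y) : ∃ V : Opens X, V ≤ U ∧ x ∈ V ∧ ∀ y ∈ V, P y := by
  obtain ⟨W, hW, hWo, hxW⟩ := eventually_nhds_iff.1 h
  exact ⟨⟨W, hWo⟩ ⊓ U, inf_le_right, ⟨hxW, hx⟩, fun y hy => hW y hy.1⟩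

variable [IsManifold 𝓘(ℂ, E) ∞ X]

theorem mdifferentiableAt_chart {x y : X} (hy : y ∈ (chartAt E x).source) :
    MDifferentiableAt 𝓘(ℂ, E) 𝓘(ℂ, E) (chartAt E x) y :=
  ((contMDiffOn_chart (I := 𝓘(ℂ, E)) (n := ∞)).contMDiffAt
    ((chartAt E x).open_source.mem_nhds hy)).mdifferentiableAt (by simp)

theorem mdifferentiableAt_chart_symm {x : X} {z : E} (hz : z ∈ (chartAt E x).target) :
    MDifferentiableAt 𝓘(ℂ, E) 𝓘(ℂ, E) (chartAt E x).symm z :=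
  ((contMDiffOn_chart_symm (I := 𝓘(ℂ, E)) (n := ∞)).contMDiffAt
    ((chartAt E x).open_target.mem_nhds hz)).mdifferentiableAt (by simp)

/-- The derivative of the preferred chart at `x`. -/
def chartDeriv (x y : X) : E →L[ℂ] E := mfderiv 𝓘(ℂ, E) 𝓘(ℂ, E) (chartAt E x) y

/-- The derivative of the inverse of the preferred chart at `x`. -/
def chartSymmDeriv (x : X) (z : E) : E →L[ℂ] E :=
  mfderiv 𝓘(ℂ, E) 𝓘(ℂ, E) (chartAt E x).symm z

theorem inChart_apply {p : ℕ} (x : X) (θ : X → Form E p) (z : E) : inChart x θ z =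
    (θ ((chartAt E x).symm z)).compContinuousLinearMap (chartSymmDeriv x z) := rfl

theorem sum_smul_compContinuousLinearMap {ι : Type*} [Fintype ι] {p : ℕ} (c : ι → ℂ)
    (a : ι → Form E p) (L : E →L[ℂ] E) : (∑ j, c j • a j).compContinuousLinearMap L =
      ∑ j, c j • (a j).compContinuousLinearMap L := by
  ext u
  simp [ContinuousAlternatingMap.sum_apply]

theorem chartDeriv_comp_chartSymmDeriv {x y : X} {z : E} (hz : z ∈ (chartAt E y).target)
    (hz' : (chartAt E y).symm z ∈ (chartAt E x).source) :
    chartDeriv x ((chartAt E y).symm z) ∘L chartSymmDeriv y z =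
      fderiv ℂ (chartAt E x ∘ (chartAt E y).symm) z := by
  rw [← mfderiv_eq_fderiv]
  exact (mfderiv_comp z (mdifferentiableAt_chart hz') (mdifferentiableAt_chart_symm hz)).symm

theorem chartSymmDeriv_comp_chartDeriv {x y : X} (hy : y ∈ (chartAt E x).source) :
    chartSymmDeriv x (chartAt E x y) ∘L chartDeriv x y = ContinuousLinearMap.id ℂ E := by
  have h := mfderiv_comp (I := 𝓘(ℂ, E)) (I' := 𝓘(ℂ, E)) (I'' := 𝓘(ℂ, E)) y
    (mdifferentiableAt_chart_symm ((chartAt E x).map_source hy)) (mdifferentiableAt_chart hy)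
  refine h.symm.trans ?_
  have h2 : (chartAt E x).symm ∘ chartAt E x =ᶠ[𝓝 y] id := by
    filter_upwards [(chartAt E x).open_source.mem_nhds hy] with w hw using (chartAt E x).left_inv hw
  rw [h2.mfderiv_eq]
  exact mfderiv_id

variable [FiniteDimensional ℂ E]
open Module

/-- The coordinate `1`-forms of the preferred chart at `x`, as forms on `X`. -/
def chartForm (x : X) (j : Fin (finrank ℂ E)) (y : X) : Form E 1 :=
  (coordForm E j).compContinuousLinearMap (chartDeriv x y)

theorem inChart_chartForm (x y : X) (j : Fin (finrank ℂ E)) {z : E}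
    (hz : z ∈ (chartAt E y).target) (hz' : (chartAt E y).symm z ∈ (chartAt E x).source) :
    inChart y (chartForm x j) z =
      (coordForm E j).compContinuousLinearMap (fderiv ℂ (chartAt E x ∘ (chartAt E y).symm) z) := by
  rw [← chartDeriv_comp_chartSymmDeriv hz hz']
  rfl

/-- In the chart at `y`, the form is a constant form pulled back by the transition map, whose
derivative is holomorphic. -/
theorem isHolomorphicFormAt_chartForm {x y : X} (hy : y ∈ (chartAt E x).source)
    (j : Fin (finrank ℂ E)) : IsHolomorphicFormAt (chartForm x j) y := by
  have h1 : ∀ᶠ z in 𝓝 (coord E y), z ∈ (chartAt E y).target ∧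
      (chartAt E y).symm z ∈ (chartAt E x).source :=
    Filter.Eventually.and ((chartAt E y).open_target.mem_nhds (mem_chart_target E y))
      (eventually_mem (U := ⟨(chartAt E x).source, (chartAt E x).open_source⟩) hy)
  filter_upwards [h1.eventually_nhds] with w hw
  have h2 : inChart y (chartForm x j) =ᶠ[𝓝 w] fun z =>
      (coordForm E j).compContinuousLinearMap (fderiv ℂ (chartAt E x ∘ (chartAt E y).symm) z) :=
    hw.mono fun z hz => inChart_chartForm x y j hz.1 hz.2
  refine ContDiffAt.congr_of_eventuallyEq ?_ h2
  have h3 : ContDiffAt ℂ ∞ (chartAt E x ∘ (chartAt E y).symm) w := by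
    rw [← contMDiffAt_iff_contDiffAt]
    have h4 : ContMDiffAt 𝓘(ℂ, E) 𝓘(ℂ, E) ∞ (chartAt E x) ((chartAt E y).symm w) :=
      contMDiffOn_chart.contMDiffAt ((chartAt E x).open_source.mem_nhds hw.self_of_nhds.2)
    exact h4.comp w (contMDiffOn_chart_symm.contMDiffAt
      ((chartAt E y).open_target.mem_nhds hw.self_of_nhds.1))
  have h5 : ContDiffAt ℂ ∞ (fderiv ℂ (chartAt E x ∘ (chartAt E y).symm)) w :=
    h3.fderiv_right (m := ∞) (by simp)
  have h6 : (fun z => (coordForm E j).compContinuousLinearMap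
      (fderiv ℂ (chartAt E x ∘ (chartAt E y).symm) z)) = fun z =>
      ContinuousAlternatingMap.ofSubsingletonLIE (𝕜 := ℂ) (E := E) (F := ℂ) (0 : Fin 1)
        (((stdBasis E).coord j).toContinuousLinearMap ∘L
          fderiv ℂ (chartAt E x ∘ (chartAt E y).symm) z) := rfl
  rw [h6]
  exact (ContinuousAlternatingMap.ofSubsingletonLIE (𝕜 := ℂ) (E := E) (F := ℂ)
    (0 : Fin 1)).contDiff.contDiffAt.comp w (contDiffAt_const.clm_comp h5)

theorem inChart_chartForm_self (x : X) (j : Fin (finrank ℂ E)) {z : E}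
    (hz : z ∈ (chartAt E x).target) : inChart x (chartForm x j) z = coordForm E j := by
  rw [inChart_chartForm x x j hz ((chartAt E x).map_target hz)]
  have h : chartAt E x ∘ (chartAt E x).symm =ᶠ[𝓝 z] id := by
    filter_upwards [(chartAt E x).open_target.mem_nhds hz] with w hw
      using (chartAt E x).right_inv hw
  rw [h.fderiv_eq, fderiv_id]
  rfl

theorem formGerm_chartForm (x : X) (j : Fin (finrank ℂ E)) :
    formGerm (chartForm x j) x (isHolomorphicFormAt_chartForm (mem_chart_source E x) j) =
      coordGerm x j := by
  refine Subtype.ext (Germ.coe_eq.2 ?_)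
  filter_upwards [(chartAt E x).open_target.mem_nhds (mem_chart_target E x)] with z hz
  exact inChart_chartForm_self x j hz

theorem eq_inChart_comp (x : X) (θ : X → Form E 1) {y : X} (hy : y ∈ (chartAt E x).source) :
    θ y = (inChart x θ (chartAt E x y)).compContinuousLinearMap (chartDeriv x y) := by
  have h : (inChart x θ (chartAt E x y)).compContinuousLinearMap (chartDeriv x y) =
      (θ ((chartAt E x).symm (chartAt E x y))).compContinuousLinearMap
        (chartSymmDeriv x (chartAt E x y) ∘L chartDeriv x y) := rfl
  rw [h, chartSymmDeriv_comp_chartDeriv hy, (chartAt E x).left_inv hy]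
  rfl

/-- A holomorphic `1`-form near `x` is a combination of the coordinate forms with holomorphic
coefficients. -/
theorem exists_coefficients (x : X) (θ : X → Form E 1) (hθ : IsHolomorphicFormAt θ x) :
    ∃ (U : Opens X) (_ : x ∈ U) (f : Fin (finrank ℂ E) → Sections E U),
      ∀ᶠ y in 𝓝 x, ∀ (hy : y ∈ U) (hy' : y ∈ (chartAt E x).source)
        (hθ' : IsHolomorphicFormAt θ y), formGerm θ y hθ' =
          ∑ j, fnGerm E hy (f j) • formGerm (chartForm x j) y
            (isHolomorphicFormAt_chartForm hy' j) := by
  choose V hV g hg using fun j =>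
    (contract x (stdBasis E j) (formGerm θ x hθ)).exists_germ
  obtain ⟨U, -, hU, hUV⟩ := exists_opens_of_eventually (U := (⊤ : Opens X)) (x := x) trivial
    (eventually_all.2 fun j => (V j).isOpen.mem_nhds (hV j))
  let f : Fin (finrank ℂ E) → Sections E U := fun j =>
    (structurePresheaf E X).map (homOfLE fun y hy => hUV y hy j).op (g j)
  have hf : ∀ j, fnGerm E hU (f j) = contract x (stdBasis E j) (formGerm θ x hθ) := fun j =>
    (fnGerm_res (fun y hy => hUV y hy j) hU (g j)).trans (hg j)
  refine ⟨U, hU, f, ?_⟩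
  have h1 : ∀ᶠ z in 𝓝 (coord E x), ∀ j, sectionInChart x (f j) z =
      inChart x θ z fun _ => stdBasis E j := eventually_all.2 fun j => by
    have h := congrArg (toGerm x) (hf j)
    rw [toGerm_contract, toGerm_fnGerm] at h
    exact Germ.coe_eq.1 h
  -- Germs at `y` are read in the chart at `y`, not in the one at `x`. The identity known in the
  -- chart at `x` is therefore first turned into a pointwise identity of forms on `X`, and then read
  -- again in the chart at `y`.
  have h2 : ∀ᶠ y in 𝓝 x, ∀ hy : y ∈ U, θ y = ∑ j, f j ⟨y, hy⟩ • chartForm x j y := by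
    filter_upwards [((chartAt E x).continuousAt (mem_chart_source E x)).eventually h1,
      (chartAt E x).open_source.mem_nhds (mem_chart_source E x)] with y hy hys hyU
    have hy' : (chartAt E x).symm (chartAt E x y) = y := (chartAt E x).left_inv hys
    rw [eq_inChart_comp x θ hys, form_eq_sum (inChart x θ (chartAt E x y))]
    rw [sum_smul_compContinuousLinearMap]
    refine Finset.sum_congr rfl fun j _ => ?_
    rw [← hy j, sectionInChart_apply (f j) (by rwa [hy'])]
    have h3 : f j ⟨(chartAt E x).symm (chartAt E x y), by rwa [hy']⟩ = f j ⟨y, hyU⟩ :=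
      congrArg (fun w : U => f j w) (Subtype.ext hy')
    rw [h3]
    rfl
  filter_upwards [h2.eventually_nhds] with y hy hyU hys hθ'
  refine Subtype.ext ?_
  have h3 : ∀ j, ((fnGerm E hyU (f j) • formGerm (chartForm x j) y
      (isHolomorphicFormAt_chartForm hys j) : FormStalk E 1 y) :
        Germ (𝓝 (coord E y)) (Form E 1)) = ((fun z => sectionInChart y (f j) z •
          inChart y (chartForm x j) z : E → Form E 1) : Germ (𝓝 (coord E y)) (Form E 1)) := by
    intro j
    change toGerm y (fnGerm E hyU (f j)) • ((inChart y (chartForm x j) : E → Form E 1) :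
      Germ (𝓝 (coord E y)) (Form E 1)) = _
    rw [toGerm_fnGerm]
    rfl
  have h4 : ((∑ j, fnGerm E hyU (f j) • formGerm (chartForm x j) y
      (isHolomorphicFormAt_chartForm hys j) : FormStalk E 1 y) :
        Germ (𝓝 (coord E y)) (Form E 1)) = ((fun z => ∑ j, sectionInChart y (f j) z •
          inChart y (chartForm x j) z : E → Form E 1) : Germ (𝓝 (coord E y)) (Form E 1)) := by
    rw [AddSubmonoidClass.coe_finsetSum]
    simp only [h3]
    have h5 := map_sum (Germ.coeAddHom (𝓝 (coord E y)) (M := Form E 1))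
      (fun j z => sectionInChart y (f j) z • inChart y (chartForm x j) z) Finset.univ
    refine h5.symm.trans (congrArg _ ?_)
    funext z
    rw [Finset.sum_apply]
  rw [h4]
  refine Germ.coe_eq.2 ?_
  have hc : Tendsto (chartAt E y).symm (𝓝 (coord E y)) (𝓝 y) := by
    have := (chartAt E y).symm.continuousAt (x := coord E y) (by simp)
    simpa [ContinuousAt] using this
  filter_upwards [hc.eventually hy, eventually_mem hyU] with z hz hzU
  rw [inChart_apply, hz hzU, sum_smul_compContinuousLinearMap]
  refine Finset.sum_congr rfl fun j _ => ?_
  rw [sectionInChart_apply (f j) hzU]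
  rfl

end
end HolConn
end

/-! ### From connections on stalks to connections on subsheaves and quotient sheaves. -/

noncomputable section
namespace HolConn
open Filter Module

section
variable {R M N : Type*} [CommRing R] [AddCommMonoid M] [Module R M] [AddCommMonoid N]
  [Module R N]
  {ι : Type*} [Fintype ι] [DecidableEq ι]

theorem exists_tensor_eq_sum (b : Basis ι R N) (t : N ⊗[R] M) :
    ∃ m : ι → M, t = ∑ i, b i ⊗ₜ m i := by
  induction t using TensorProduct.induction_on with
  | zero => exact ⟨0, by simp⟩
  | add s t hs ht =>
    obtain ⟨m, rfl⟩ := hs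
    obtain ⟨n, rfl⟩ := ht
    exact ⟨m + n, by simp [TensorProduct.tmul_add, Finset.sum_add_distrib]⟩
  | tmul n m =>
    refine ⟨fun i => b.repr n i • m, ?_⟩
    conv_lhs => rw [← b.sum_repr n, TensorProduct.sum_tmul]
    simp only [TensorProduct.smul_tmul]

/-- Contracting the first factor with the dual basis recovers the components. -/
theorem tensor_sum_injective (b : Basis ι R N) {m n : ι → M}
    (h : ∑ i, b i ⊗ₜ[R] m i = ∑ i, b i ⊗ₜ[R] n i) : m = n := by
  funext j
  have h1 := congrArg (fun t => TensorProduct.lid R M ((b.coord j).rTensor M t)) h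
  simpa [map_sum, Finsupp.single_apply, ite_smul] using h1

end

variable {E : Type} [NormedAddCommGroup E] [NormedSpace ℂ E] [FiniteDimensional ℂ E]
variable {X : Type} [TopologicalSpace X] [ChartedSpace E X] [IsManifold 𝓘(ℂ, E) ∞ X]
variable {F G : OMod E X}

theorem lTensor_injective {x : X} {M N : Type} [AddCommGroup M] [Module (LocalRing E x) M]
    [AddCommGroup N] [Module (LocalRing E x) N] {φ : M →ₗ[LocalRing E x] N}
    (h : Function.Injective φ) : Function.Injective (φ.lTensor (FormStalk E 1 x)) :=
  Module.Flat.lTensor_preserves_injective_linearMap φ h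

namespace Connection

/-- Locally, the values of a connection are combinations of the coordinate forms of a chart. -/
theorem exists_eq_sum_chartForm (α : Connection F) {U : Opens X} (s : F.Sec U) {x : X} (hx : x ∈ U) :
    ∃ (V : Opens X) (hV : V ≤ U) (_ : x ∈ V) (hs : ∀ y ∈ V, y ∈ (chartAt E x).source)
      (t : Fin (finrank ℂ E) → F.Sec V), ∀ (y : X) (hy : y ∈ V),
        α.toFun y (F.germ (hV hy) s) = ∑ j, formGerm (chartForm x j) y
          (isHolomorphicFormAt_chartForm (hs y hy) j) ⊗ₜ F.germ hy (t j) := by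
  obtain ⟨V, hVU, hxV, k, θ, hθ, t, ht⟩ := α.continuous U s x hx
  choose W hW f hf using fun i => exists_coefficients x (θ i) (hθ i x hxV)
  obtain ⟨V', hV'V, hxV', hV'⟩ := exists_opens_of_eventually hxV
    (((eventually_all.2 fun i => (W i).isOpen.mem_nhds (hW i)).and (eventually_all.2 hf)).and
      ((chartAt E x).open_source.mem_nhds (mem_chart_source E x)))
  have hV'W : ∀ i, V' ≤ W i := fun i y hy => (hV' y hy).1.1 i
  let f' : Fin k → Fin (finrank ℂ E) → Sections E V' := fun i j =>
    (structurePresheaf E X).map (homOfLE (hV'W i)).op (f i j)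
  have hf' : ∀ i j y (hy : y ∈ V'), fnGerm E hy (f' i j) = fnGerm E (hV'W i hy) (f i j) :=
    fun i j y hy => fnGerm_res (hV'W i) hy (f i j)
  refine ⟨V', hV'V.trans hVU, hxV', fun y hy => (hV' y hy).2,
    fun j => ∑ i, f' i j • F.res hV'V (t i), fun y hy => ?_⟩
  refine (ht y (hV'V hy)).trans ?_
  simp only [map_sum, OMod.germ_smul, OMod.germ_res, TensorProduct.tmul_sum, hf']
  rw [Finset.sum_comm]
  refine Finset.sum_congr rfl fun i _ => ?_
  rw [(hV' y hy).1.2 i (hV'W i hy) (hV' y hy).2 (hθ i y (hV'V hy)), TensorProduct.sum_tmul]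
  simp only [TensorProduct.smul_tmul]

/-- The stalk maps come from `StalkConnection.exists_of_injective`; local coherence between them is
what remains. Near `x`, expand `β (ι s)` in the coordinate frame with coefficients `t j` in `G`. At
`x` the coefficients in a frame are unique, so the germ of `t j` comes from some `m j` in the stalk
of `F`. A section of `F` representing `m j` maps to `t j` on a whole neighbourhood, and injectivity
of `1 ⊗ ι` there makes these sections the coefficients of `α s`. -/
theorem exists_of_mono (ι : F ⟶ G) [Mono ι] (β : Connection G)
    (h : ∀ (x : X) (s : F.Stalk x), ∃ t, (OMod.stalkMap ι x).lTensor (FormStalk E 1 x) t =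
      β.toFun x (OMod.stalkMap ι x s)) : ∃ α : Connection F, Compatible ι α β := by
  have hinj := fun x => lTensor_injective (stalkMap_injective ι x)
  choose α hα using fun x => StalkConnection.exists_of_injective (hinj x) (β.atStalk x) (h x)
  refine ⟨⟨fun x => (α x).toFun, fun x => (α x).leibniz, fun U s x hx => ?_⟩, hα⟩
  obtain ⟨s', hs'⟩ := OMod.exists_stalkMap_germ ι s
  obtain ⟨V, hVU, hxV, hsrc, t, ht⟩ := β.exists_eq_sum_chartForm s' hx
  have hkey : ∀ (y : X) (hy : y ∈ V), (OMod.stalkMap ι y).lTensor (FormStalk E 1 y)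
      ((α y).toFun (F.germ (hVU hy) s)) = ∑ j, formGerm (chartForm x j) y
        (isHolomorphicFormAt_chartForm (hsrc y hy) j) ⊗ₜ G.germ hy (t j) := fun y hy => by
    rw [hα, hs']
    exact ht y hy
  obtain ⟨m, hm⟩ := exists_tensor_eq_sum (formBasis x) ((α x).toFun (F.germ hx s))
  have hm' : ∀ j, OMod.stalkMap ι x (m j) = G.germ hxV (t j) := by
    have h1 := hkey x hxV
    rw [hm, map_sum] at h1
    simp only [LinearMap.lTensor_tmul] at h1
    have h2 : ∀ j, formGerm (chartForm x j) x
        (isHolomorphicFormAt_chartForm (hsrc x hxV) j) = formBasis x j := fun j => by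
      rw [formGerm_chartForm]
      simp [formBasis, Basis.ofEquivFun, Pi.single_apply]
    simp only [h2] at h1
    exact fun j => congrFun (tensor_sum_injective (formBasis x) h1) j
  choose W hW σ hσ using fun j => F.exists_germ (m j)
  choose σ' hσ' using fun j => OMod.exists_stalkMap_germ ι (σ j)
  have h3 : ∀ j, ∀ᶠ y in 𝓝 x, ∃ (h₁ : y ∈ W j) (h₂ : y ∈ V),
      G.germ h₁ (σ' j) = G.germ h₂ (t j) := fun j =>
    OMod.exists_germ_eqOn (hW j) hxV (by rw [← hσ' j x (hW j), hσ, hm'])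
  obtain ⟨V', hV'V, hxV', hV'⟩ := exists_opens_of_eventually hxV (eventually_all.2 h3)
  have hV'W : ∀ j, V' ≤ W j := fun j y hy => (hV' y hy j).1
  refine ⟨V', hV'V.trans hVU, hxV', finrank ℂ E, chartForm x,
    fun j y hy => isHolomorphicFormAt_chartForm (hsrc y (hV'V hy)) j,
    fun j => F.res (hV'W j) (σ j), fun y hy => hinj y ?_⟩
  rw [hkey y (hV'V hy), map_sum]
  refine Finset.sum_congr rfl fun j _ => ?_
  obtain ⟨_, _, h4⟩ := hV' y hy j
  rw [LinearMap.lTensor_tmul, OMod.germ_res, hσ' j y (hV'W j hy), h4]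

/-- The stalk maps come from `StalkConnection.exists_of_surjective`. For the local form near `x`,
lift the germ of `s` to a section `σ` of `F`; then `π σ` and `s` agree near `x`, and `π` carries a
local expression of `α σ` to one of `β s`. -/
theorem exists_of_epi (π : F ⟶ G) [Epi π] (α : Connection F)
    (h : ∀ (x : X) (s : F.Stalk x), OMod.stalkMap π x s = 0 →
      (OMod.stalkMap π x).lTensor (FormStalk E 1 x) (α.toFun x s) = 0) :
    ∃ β : Connection G, Compatible π α β := by
  have hsurj := fun x => stalkMap_surjective (E := E) π x
  choose β hβ using fun x => StalkConnection.exists_of_surjective (hsurj x) (α.atStalk x) (h x)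
  refine ⟨⟨fun x => (β x).toFun, fun x => (β x).leibniz, fun U s x hx => ?_⟩, hβ⟩
  obtain ⟨σ₀, hσ₀⟩ := hsurj x (G.germ hx s)
  obtain ⟨W, hxW, σ, rfl⟩ := F.exists_germ σ₀
  obtain ⟨σ', hσ'⟩ := OMod.exists_stalkMap_germ π σ
  obtain ⟨V, hVW, hxV, k, θ, hθ, t, ht⟩ := α.continuous W σ x hxW
  choose t' ht' using fun i => OMod.exists_stalkMap_germ π (t i)
  obtain ⟨V', hV'V, hxV', hV'⟩ := exists_opens_of_eventually hxV
    (OMod.exists_germ_eqOn hxW hx ((hσ' x hxW).symm.trans hσ₀))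
  have hV'U : V' ≤ U := fun y hy => (hV' y hy).2.1
  refine ⟨V', hV'U, hxV', k, θ, fun i y hy => hθ i y (hV'V hy), fun i => G.res hV'V (t' i),
    fun y hy => ?_⟩
  obtain ⟨h₁, _, h₂⟩ := hV' y hy
  rw [← h₂, ← hσ' y h₁, ← hβ y]
  refine (congrArg ((OMod.stalkMap π y).lTensor (FormStalk E 1 y)) (ht y (hV'V hy))).trans ?_
  rw [map_sum]
  refine Finset.sum_congr rfl fun i _ => ?_
  rw [LinearMap.lTensor_tmul, OMod.germ_res, ht' i y (hV'V hy)]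

theorem eq_of_compatible_mono (ι : F ⟶ G) [Mono ι] {α α' : Connection F} {β : Connection G}
    (h : Compatible ι α β) (h' : Compatible ι α' β) : α = α' :=
  Connection.ext <| funext fun x => AddMonoidHom.ext fun s =>
    lTensor_injective (stalkMap_injective ι x) ((h x s).trans (h' x s).symm)

theorem eq_of_compatible_epi (π : F ⟶ G) [Epi π] {α : Connection F} {β β' : Connection G}
    (h : Compatible π α β) (h' : Compatible π α β') : β = β' :=
  Connection.ext <| funext fun x => AddMonoidHom.ext fun s => by
    obtain ⟨s, rfl⟩ := stalkMap_surjective π x s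
    exact (h x s).symm.trans (h' x s)

end Connection
end HolConn
end

/-! ### Complexes: induced connections on cohomology and the alternating sum. -/

noncomputable section
namespace HolConn
open Module

section
variable {E : Type} [NormedAddCommGroup E] [NormedSpace ℂ E]
variable {X : Type} [TopologicalSpace X] [ChartedSpace E X]

theorem IsCoherent.finite_stalk {F : OMod E X} (hF : IsCoherent F) (x : X) :
    Module.Finite (LocalRing E x) (F.Stalk x) := by
  obtain ⟨U, hx, k, s, hs⟩ := hF.1 x
  exact ⟨⟨(Set.finite_range fun i => F.germ hx (s i)).toFinset, by simpa using hs x hx⟩⟩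

/-- The kernel of a morphism of coherent sheaves has finitely generated stalks. -/
theorem IsCoherent.ker_stalkMap_fg {F G : OMod E X} (hF : IsCoherent F) (hG : IsCoherent G)
    (f : F ⟶ G) (x : X) : (LinearMap.ker (OMod.stalkMap f x)).FG := by
  obtain ⟨U, hx, k, s, hs⟩ := hF.1 x
  choose t ht using fun i => OMod.exists_stalkMap_germ f (s i)
  obtain ⟨V, hVU, hxV, l, r, hr⟩ := hG.2 U k t x hx
  have hker := hr x hxV
  let p := Fintype.linearCombination (LocalRing E x) fun i => F.germ hx (s i)
  have hp : LinearMap.range p = ⊤ :=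
    (Fintype.range_linearCombination (LocalRing E x) (v := fun i => F.germ hx (s i))).trans (hs x hx)
  have hcomp : OMod.stalkMap f x ∘ₗ p =
      Fintype.linearCombination (LocalRing E x) fun i => G.germ (hVU hxV) (t i) := by
    refine LinearMap.ext fun c => ?_
    simp only [p, LinearMap.comp_apply, Fintype.linearCombination_apply, map_sum, map_smul, ht]
  -- Since `p` is onto, the kernel is the image of the kernel of the composite, which is the module
  -- of relations between the images of the generators. Coherence of `G` makes the latter finitely
  -- generated.
  have h1 : LinearMap.ker (OMod.stalkMap f x) = (LinearMap.ker (OMod.stalkMap f x ∘ₗ p)).map p := by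
    rw [LinearMap.ker_comp, Submodule.map_comap_eq, hp, top_inf_eq]
  rw [h1, hcomp, hker]
  exact (Submodule.fg_span (Set.finite_range _)).map p

theorem stalkMap_zero (F G : OMod E X) (x : X) : OMod.stalkMap (0 : F ⟶ G) x = 0 := by
  refine LinearMap.ext fun s => ?_
  obtain ⟨U, hx, s, rfl⟩ := F.exists_germ s
  refine (OMod.stalkMapAdd_germ (0 : F ⟶ G) hx s).trans ?_
  exact map_zero (G.germ hx)

section Complex
variable (K : CochainComplex (OMod E X) ℤ) (i j : ℤ)

theorem exact_iCycles_d (x : X) :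
    Function.Exact (OMod.stalkMap (K.iCycles i) x) (OMod.stalkMap (K.d i (i + 1)) x) :=
  stalkMap_exact (ShortComplex.mk _ _ (K.iCycles_d i (i + 1)))
    (ShortComplex.exact_of_f_is_kernel _ (K.cyclesIsKernel i (i + 1) (by simp))) x

theorem exact_toCycles_homologyπ (x : X) :
    Function.Exact (OMod.stalkMap (K.toCycles i (i + 1)) x)
      (OMod.stalkMap (K.homologyπ (i + 1)) x) :=
  stalkMap_exact (ShortComplex.mk _ _ (K.toCycles_comp_homologyπ i (i + 1)))
    (ShortComplex.exact_of_g_is_cokernel _ (K.homologyIsCokernel i (i + 1) (by simp))) x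

theorem stalkMap_iCycles_toCycles (x : X) (s : (K.X i).Stalk x) :
    OMod.stalkMap (K.iCycles j) x (OMod.stalkMap (K.toCycles i j) x s) =
      OMod.stalkMap (K.d i j) x s := by
  rw [← LinearMap.comp_apply, ← stalkMap_comp, K.toCycles_i]

end Complex
end

variable {E : Type} [NormedAddCommGroup E] [NormedSpace ℂ E] [FiniteDimensional ℂ E]
variable {X : Type} [TopologicalSpace X] [ChartedSpace E X] [IsManifold 𝓘(ℂ, E) ∞ X]

theorem StalkConnection.tracePairing_eq_zero {x : X} {M : Type} [AddCommGroup M]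
    [Module (LocalRing E x) M] [Subsingleton M] (α : StalkConnection E x M) (u v : Fin 2 → E) :
    α.tracePairing u v = 0 := by
  have : α.fiberCurvature u = 0 := LinearMap.ext fun t => by
    induction t using TensorProduct.induction_on with
    | zero => rw [map_zero, map_zero]
    | add s t hs ht => rw [map_add, map_add, hs, ht]
    | tmul c m => rw [Subsingleton.elim m 0, TensorProduct.tmul_zero, map_zero, map_zero]
  rw [tracePairing, this, zero_mul, map_zero]

section Complex
variable {K : CochainComplex (OMod E X) ℤ} {D : ∀ i, Connection (K.X i)}
  (hD : ∀ i, Connection.Compatible (K.d i (i + 1)) (D i) (D (i + 1)))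
include hD

/-- For `s` in the kernel, compatibility gives `(1 ⊗ d)(∇ s) = ∇ (d s) = 0`, and flatness of `Ω^1_x`
puts `∇ s` in the image of `Ω^1_x ⊗ Z_x`, with `Z` the sheaf of cycles. -/
theorem exists_connection_cycles (i : ℤ) :
    ∃ ζ : Connection (K.cycles i), Connection.Compatible (K.iCycles i) ζ (D i) := by
  refine Connection.exists_of_mono (K.iCycles i) (D i) fun x s => ?_
  have h := Module.Flat.lTensor_exact (FormStalk E 1 x) (exact_iCycles_d K i x)
  refine (h _).1 ?_
  rw [hD i x, (exact_iCycles_d K i x).apply_apply_eq_zero, map_zero]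

/-- The identity may be tested after the injection of `Ω^1_x ⊗ Z_x` into `Ω^1_x ⊗ K_x`, where it is
the compatibility of `K.d`. -/
theorem compatible_toCycles (i : ℤ) {ζ : Connection (K.cycles (i + 1))}
    (h : Connection.Compatible (K.iCycles (i + 1)) ζ (D (i + 1))) :
    Connection.Compatible (K.toCycles i (i + 1)) (D i) ζ := fun x s => by
  refine lTensor_injective (stalkMap_injective (K.iCycles (i + 1)) x) ?_
  rw [h x, stalkMap_iCycles_toCycles, ← hD i x s, ← LinearMap.comp_apply, ← LinearMap.lTensor_comp,
    ← stalkMap_comp, K.toCycles_i]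

/-- A cycle that dies in cohomology is a boundary; its derivative is the image of an element of
`Ω^1_x ⊗ K_x` under the tensored differential, hence dies as well. -/
theorem exists_connection_homology (i : ℤ) {ζ : Connection (K.cycles (i + 1))}
    (h : Connection.Compatible (K.iCycles (i + 1)) ζ (D (i + 1))) :
    ∃ θ : Connection (K.homology (i + 1)), Connection.Compatible (K.homologyπ (i + 1)) ζ θ := by
  refine Connection.exists_of_epi (K.homologyπ (i + 1)) ζ fun x s hs => ?_
  obtain ⟨r, rfl⟩ := (exact_toCycles_homologyπ K i x s).1 hs
  rw [← compatible_toCycles hD i h x r]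
  exact (lTensor_exact (FormStalk E 1 x) (exact_toCycles_homologyπ K i x)
    (stalkMap_surjective _ x)).apply_apply_eq_zero _

/-- The connection induced on cohomology exists and is unique. -/
theorem existsUnique_isInduced (i : ℤ) :
    ∃! θ : Connection (K.homology i), IsInduced K i (D i) θ := by
  obtain ⟨i, rfl⟩ : ∃ j, i = j + 1 := ⟨i - 1, by ring⟩
  obtain ⟨ζ, hζ⟩ := exists_connection_cycles hD (i + 1)
  obtain ⟨θ, hθ⟩ := exists_connection_homology hD i hζ
  refine ⟨θ, ⟨ζ, hζ, hθ⟩, ?_⟩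
  rintro θ' ⟨ζ', hζ', hθ'⟩
  obtain rfl := Connection.eq_of_compatible_mono (K.iCycles (i + 1)) hζ hζ'
  exact Connection.eq_of_compatible_epi (K.homologyπ (i + 1)) hθ' hθ

/-- This quotient of stalks stands for the image of the differential. A connection on the module at
`x` is all that freeness and the trace pairing need, so no image sheaf is introduced. -/
theorem exists_connection_quotient (i : ℤ) (x : X) :
    ∃ κ : StalkConnection E x ((K.X i).Stalk x ⧸ LinearMap.ker (OMod.stalkMap (K.d i (i + 1)) x)),
      StalkConnection.Compatible (Submodule.mkQ _) ((D i).atStalk x) κ := by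
  refine StalkConnection.exists_of_surjective (Submodule.mkQ_surjective _) _ fun s hs => ?_
  obtain ⟨ζ, hζ⟩ := exists_connection_cycles hD i
  have hs' : OMod.stalkMap (K.d i (i + 1)) x s = 0 := (Submodule.Quotient.mk_eq_zero _).1 hs
  obtain ⟨r, rfl⟩ := (exact_iCycles_d K i x s).1 hs'
  refine (congrArg _ (hζ x r).symm).trans ?_
  rw [← LinearMap.comp_apply, ← LinearMap.lTensor_comp]
  have h0 : (LinearMap.ker (OMod.stalkMap (K.d i (i + 1)) x)).mkQ ∘ₗ
      OMod.stalkMap (K.iCycles i) x = 0 := LinearMap.ext fun r =>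
    (Submodule.Quotient.mk_eq_zero _).2 ((exact_iCycles_d K i x).apply_apply_eq_zero r)
  rw [h0, LinearMap.lTensor_zero, LinearMap.zero_apply]

end Complex

theorem sum_negOnePow_telescope (q : ℤ → ℂ) {a b : ℤ} (hab : a ≤ b) :
    ∑ i ∈ Finset.Icc a b, i.negOnePow • (q i + q (i - 1)) =
      b.negOnePow • q b + a.negOnePow • q (a - 1) := by
  induction b, hab using Int.leInduction with
  | base => simp
  | succ b hb ih =>
    have h : Finset.Icc a (b + 1) = insert (b + 1) (Finset.Icc a b) := by
      ext i; simp only [Finset.mem_insert, Finset.mem_Icc]; omega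
    rw [h, Finset.sum_insert (by simp), ih, Int.negOnePow_succ, add_sub_cancel_right, smul_add,
      Units.neg_smul, Units.neg_smul]
    abel

/-- Euler characteristic bookkeeping: `c`, `q`, `h` stand for the contributions of the terms, of the
images of the differentials and of the cohomology. -/
theorem sum_negOnePow_eq {c q h : ℤ → ℂ} {a b : ℤ} (hc : ∀ i, c i = q i + q (i - 1) + h i)
    (hb : q b = 0) (ha : q (a - 1) = 0) :
    ∑ i ∈ Finset.Icc a b, i.negOnePow • c i = ∑ i ∈ Finset.Icc a b, i.negOnePow • h i := by
  by_cases hab : a ≤ b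
  · simp only [hc, smul_add _ (_ + _) (h _), Finset.sum_add_distrib (g := fun i : ℤ =>
      i.negOnePow • h i)]
    rw [sum_negOnePow_telescope q hab, hb, ha, smul_zero, smul_zero, zero_add, zero_add]
  · rw [Finset.Icc_eq_empty hab, Finset.sum_empty, Finset.sum_empty]

/-- Additivity is applied to cycles, term, image and to image, cycles, cohomology. The quotients in
both sequences are finite modules with connections, hence free at `x`. Coherence enters through the
finiteness of the stalks of the terms and of the cycles. -/
theorem sum_tracePairing_eq {K : CochainComplex (OMod E X) ℤ} {D : ∀ i, Connection (K.X i)}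
    (hD : ∀ i, Connection.Compatible (K.d i (i + 1)) (D i) (D (i + 1))) {a b : ℤ}
    (hK : ∀ i, i ∉ Finset.Icc a b → Limits.IsZero (K.X i)) (hcoh : ∀ i, IsCoherent (K.X i))
    {θ : ∀ i, Connection (K.homology i)} (hθ : ∀ i, IsInduced K i (D i) (θ i)) (x : X)
    (u v : Fin 2 → E) :
    ∑ i ∈ Finset.Icc a b, i.negOnePow • ((D i).atStalk x).tracePairing u v =
      ∑ i ∈ Finset.Icc a b, i.negOnePow • ((θ i).atStalk x).tracePairing u v := by
  choose ζ hζ hπ using hθ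
  choose κ hκ using fun i => exists_connection_quotient hD i x
  have hfin := fun i => (hcoh i).finite_stalk x
  have hZfin : ∀ i, Module.Finite (LocalRing E x) ((K.cycles i).Stalk x) := fun i => by
    have h1 : LinearMap.range (OMod.stalkMap (K.iCycles i) x) =
        LinearMap.ker (OMod.stalkMap (K.d i (i + 1)) x) :=
      (LinearMap.exact_iff.1 (exact_iCycles_d K i x)).symm
    have h2 := (hcoh i).ker_stalkMap_fg (hcoh (i + 1)) (K.d i (i + 1)) x
    rw [← h1] at h2
    have : Module.Finite (LocalRing E x) (LinearMap.range (OMod.stalkMap (K.iCycles i) x)) :=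
      Module.Finite.iff_fg.2 h2
    exact Module.Finite.equiv
      (LinearEquiv.ofInjective _ (stalkMap_injective (K.iCycles i) x)).symm
  have hHfin : ∀ i, Module.Finite (LocalRing E x) ((K.homology i).Stalk x) := fun i =>
    Module.Finite.of_surjective _ (stalkMap_surjective (K.homologyπ i) x)
  have hHfree : ∀ i, Module.Free (LocalRing E x) ((K.homology i).Stalk x) := fun i =>
    ((θ i).atStalk x).free
  have hQfree := fun i => (κ i).free
  have h1 : ∀ i, ((D i).atStalk x).tracePairing u v =
      ((ζ i).atStalk x).tracePairing u v + (κ i).tracePairing u v := fun i => by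
    refine StalkConnection.tracePairing_eq_add (stalkMap_injective (K.iCycles i) x) ?_
      (Submodule.mkQ_surjective _) ((hζ i).atStalk x) (hκ i) u v
    rw [LinearMap.exact_iff, Submodule.ker_mkQ]
    exact LinearMap.exact_iff.1 (exact_iCycles_d K i x)
  have h2 : ∀ i, ((ζ (i + 1)).atStalk x).tracePairing u v =
      (κ i).tracePairing u v + ((θ (i + 1)).atStalk x).tracePairing u v := fun i => by
    have hker : LinearMap.ker (OMod.stalkMap (K.d i (i + 1)) x) =
        LinearMap.ker (OMod.stalkMap (K.toCycles i (i + 1)) x) := by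
      ext s
      rw [LinearMap.mem_ker, LinearMap.mem_ker, ← stalkMap_iCycles_toCycles,
        map_eq_zero_iff _ (stalkMap_injective (K.iCycles (i + 1)) x)]
    -- The embedding of the image of the differential into the next cycles. It is compatible with
    -- the connections because `mkQ` is surjective and both `mkQ` and its composite with `φ` are
    -- compatible.
    let φ := (LinearMap.ker (OMod.stalkMap (K.d i (i + 1)) x)).liftQ
      (OMod.stalkMap (K.toCycles i (i + 1)) x) hker.le
    have hφ : φ ∘ₗ Submodule.mkQ _ = OMod.stalkMap (K.toCycles i (i + 1)) x :=
      Submodule.liftQ_mkQ _ _ _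
    refine StalkConnection.tracePairing_eq_add (f := φ) ?_ ?_
      (stalkMap_surjective (K.homologyπ (i + 1)) x) ?_ ((hπ (i + 1)).atStalk x) u v
    · rw [← LinearMap.ker_eq_bot, Submodule.ker_liftQ_eq_bot']
      exact hker
    · rw [LinearMap.exact_iff, Submodule.range_liftQ]
      exact LinearMap.exact_iff.1 (exact_toCycles_homologyπ K i x)
    · intro s
      obtain ⟨s, rfl⟩ := Submodule.mkQ_surjective _ s
      rw [← hκ i s, ← LinearMap.comp_apply, ← LinearMap.lTensor_comp, ← LinearMap.comp_apply φ, hφ]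
      exact compatible_toCycles hD i (hζ (i + 1)) x s
  have h3 : ∀ i, K.d i (i + 1) = 0 → (κ i).tracePairing u v = 0 := fun i hi => by
    have : Subsingleton
        ((K.X i).Stalk x ⧸ LinearMap.ker (OMod.stalkMap (K.d i (i + 1)) x)) := by
      rw [Submodule.Quotient.subsingleton_iff, LinearMap.ker_eq_top, hi, stalkMap_zero]
    exact (κ i).tracePairing_eq_zero u v
  -- The two boundary terms vanish because the differential out of degree `b` has zero target and
  -- the one out of degree `a - 1` has zero source.
  refine sum_negOnePow_eq (q := fun i => (κ i).tracePairing u v) (fun i => ?_)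
    (h3 b ((hK (b + 1) (by simp)).eq_of_tgt _ _))
    (h3 (a - 1) ((hK (a - 1) (by simp)).eq_of_src _ _))
  obtain ⟨i, rfl⟩ : ∃ j, i = j + 1 := ⟨i - 1, by ring⟩
  rw [h1, h2, add_sub_cancel_right]
  ring

end HolConn
end

theorem proposition3p2
    (E : Type) [NormedAddCommGroup E] [NormedSpace ℂ E] [FiniteDimensional ℂ E]
    (X : Type) [TopologicalSpace X] [ChartedSpace E X] [IsManifold 𝓘(ℂ, E) ∞ X]
    (g : KahlerMetric E X) :
    (∀ (A B C : OMod E X) (_ : IsCoherent A) (_ : IsCoherent B) (_ : IsCoherent C)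
      (α : Connection A) (β : Connection B) (γ : Connection C)
      (f : A ⟶ B) (p : B ⟶ C) (w : f ≫ p = 0) (_ : (ShortComplex.mk f p w).ShortExact)
      (_ : Connection.Compatible f α β) (_ : Connection.Compatible p β γ)
      (x : X) (_ : x ∉ singularSet A ∪ singularSet B ∪ singularSet C),
      Phi g β x = Phi g α x + Phi g γ x ∧
      ∀ u v : Fin 2 → E,
        LinearMap.trace ℂ (B.Fiber x) (β.curvatureAt x u * β.curvatureAt x v) =
          LinearMap.trace ℂ (A.Fiber x) (α.curvatureAt x u * α.curvatureAt x v) +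
          LinearMap.trace ℂ (C.Fiber x) (γ.curvatureAt x u * γ.curvatureAt x v)) ∧
    (∀ (K : CochainComplex (OMod E X) ℤ) (a b : ℤ)
      (_ : ∀ i, i ∉ Finset.Icc a b → Limits.IsZero (K.X i)) (_ : ∀ i, IsCoherent (K.X i))
      (D : ∀ i, Connection (K.X i))
      (_ : ∀ i, Connection.Compatible (K.d i (i + 1)) (D i) (D (i + 1))),
      (∀ i, ∃! θ : Connection (K.homology i), IsInduced K i (D i) θ) ∧
      ∀ θ : ∀ i, Connection (K.homology i), (∀ i, IsInduced K i (D i) (θ i)) →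
        ∀ x ∉ ⋃ i, singularSet (K.X i),
          ∑ i ∈ Finset.Icc a b, i.negOnePow • Phi g (D i) x =
            ∑ i ∈ Finset.Icc a b, i.negOnePow • Phi g (θ i) x ∧
          ∀ u v : Fin 2 → E,
            ∑ i ∈ Finset.Icc a b, i.negOnePow •
              LinearMap.trace ℂ ((K.X i).Fiber x)
                ((D i).curvatureAt x u * (D i).curvatureAt x v) =
            ∑ i ∈ Finset.Icc a b, i.negOnePow •
              LinearMap.trace ℂ ((K.homology i).Fiber x)
                ((θ i).curvatureAt x u * (θ i).curvatureAt x v)) := by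
  refine ⟨fun A B C _ hB _ α β γ f p w hS hf hp x hx => ?_,
    fun K a b hK hcoh D hD => ⟨existsUnique_isInduced hD, fun θ hθ x _ => ?_⟩⟩
  · have hfin := hB.finite_stalk x
    have hfree : Module.Free (LocalRing E x) (C.Stalk x) := by
      by_contra h
      exact hx (Or.inr h)
    have := hS.mono_f
    have := hS.epi_g
    -- The identity for pairs of tangent vectors implies the one for `Phi`; the same holds for the
    -- complex below.
    have key : ∀ u v, (β.atStalk x).tracePairing u v =
        (α.atStalk x).tracePairing u v + (γ.atStalk x).tracePairing u v :=
      StalkConnection.tracePairing_eq_add (stalkMap_injective f x) (stalkMap_exact _ hS.exact x)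
        (stalkMap_surjective p x) (hf.atStalk x) (hp.atStalk x)
    exact ⟨Phi_eq_add g x key, key⟩
  · have key := sum_tracePairing_eq hD hK hcoh hθ x
    exact ⟨sum_Phi_eq g x D θ _ key, key⟩
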